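/- Let $X$ be a finite set with $n>1$ elements. A weak order on $X$ is a transitive, strongly complete relation $W\subseteq X\times X$ (for all $x,y$, $(x,y)\in W$ or $(y,x)\in W$); a linear order is an antisymmetric weak order; $\mathbf{WO}$ is the set of all weak orders on $X$, ordered by inclusion. A weak $2$-order is a weak order $U$ whose indifference relation $U\cap U^{-1}$ has exactly two classes; $\mathbf{WO}(2)$ is the set of these. For $W\in\mathbf{WO}$ let $J_W=\{U\in\mathbf{WO}(2): W\subseteq U\}$, with characteristic vector $\chi(J_W)\in\mathbb{R}^{\mathbf{WO}(2)}$. Let $\mathcal{C}(\mathbf{WO})$ be the collection of all polytopes $\operatorname{conv}\{\chi(J_W): W\supseteq L\}$, $L$ a linear order on $X$, together with all their faces. A combinatorial $m$-cube is a polytope whose face lattice is isomorphic to that of $[0,1]^m$. A polytopal complex is a finite collection of polytopes which contains the empty polytope and all faces of its members, and in which the intersection of any two members is a face of both; it is cubical if all its nonempty members are combinatorial cubes. It is a subdivision of a polytope $P$ if the union of its members is $P$. Two complexes are isomorphic if their face posets (ordered by inclusion, with the empty face) are isomorphic. The graph of a complex consists of its $0$- and $1$-dimensional cells. Let $\Pi_{n-1}\subset\mathbb{R}^X$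 be the permutahedron, i.e. the convex hull of all vectors whose coordinates are $1,\dots,n$ in some order. A vertex $v$ of $\Pi_{n-1}$ represents the linear order $\{(x,y): v_x\le v_y\}$ on $X$. For a vertex $L$ of $\Pi_{n-1}$, let $C_L$ be the convex hull of the barycenters (vertex averages) of all faces of $\Pi_{n-1}$ containing $L$. Then: 1. each $C_L$ is a combinatorial $(n-1)$-cube; 2. the polytopes $C_L$, $L$ a vertex of $\Pi_{n-1}$, together with all their faces, form a subdivision of $\Pi_{n-1}$; 3. this subdivision is a cubical complex; 4. it is isomorphic to $\mathcal{C}(\mathbf{WO})$, by an isomorphism which sends each $C_L$ to $\operatorname{conv}\{\chi(J_W): W\supseteq L'\}$, where $L'$ is the linear order represented by the vertex $L$; 5. its graph, and likewise the graph of $\mathcal{C}(\mathbf{WO})$, is isomorphic to the (undirected) Hasse diagram of $\mathbf{WO}$. -/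

import Mathlib

namespace WeakOrderComplex

/-! ### Polytopes, faces, cubes and polytopal complexes -/

section Polytopes

variable {E : Type*} [AddCommGroup E] [Module ℝ E] [TopologicalSpace E]

/-- A polytope: the convex hull of a finite set of points. -/
def IsPolytope (P : Set E) : Prop :=
  ∃ s : Set E, s.Finite ∧ P = convexHull ℝ s

/-- The faces of `P`, the empty face and `P` itself included: the empty set and the sets of
maximizers over `P` of linear functionals. As a type it is ordered by inclusion, and so it is the
face lattice of `P`. -/
def faces (P : Set E) : Set (Set E) :=
  {F | IsExposed ℝ P F}

/-- The vertices of `P`: the points `v` such that `{v}` is a face. -/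
abbrev vertices (P : Set E) : Set E :=
  P.exposedPoints ℝ

/-- The barycenter of a polytope: the average of its vertices. -/
noncomputable def barycenter (P : Set E) : E :=
  ((vertices P).ncard : ℝ)⁻¹ • ∑ᶠ v ∈ vertices P, v

/-- A combinatorial `m`-cube: a polytope whose face lattice is isomorphic to that
of `[0,1]^m`. -/
def IsCombinatorialCube (m : ℕ) (P : Set E) : Prop :=
  IsPolytope P ∧ Nonempty (faces P ≃o faces (Set.Icc (0 : Fin m → ℝ) 1))

/-- A polytopal complex: a finite collection of polytopes that contains the empty polytope and all
faces of its members, and in which any two members meet in a common face. -/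
structure IsPolytopalComplex (C : Set (Set E)) : Prop where
  finite : C.Finite
  isPolytope : ∀ P ∈ C, IsPolytope P
  empty_mem : ∅ ∈ C
  face_mem : ∀ P ∈ C, ∀ F ∈ faces P, F ∈ C
  inter_mem : ∀ P ∈ C, ∀ Q ∈ C, P ∩ Q ∈ faces P ∧ P ∩ Q ∈ faces Q

/-- A cubical complex: a polytopal complex all of whose (nonempty) members are cubes. -/
def IsCubicalComplex (C : Set (Set E)) : Prop :=
  IsPolytopalComplex C ∧ ∀ P ∈ C, P.Nonempty → ∃ m : ℕ, IsCombinatorialCube m P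

/-- A polytopal subdivision of `P`: a polytopal complex with underlying set `P`. -/
def IsSubdivision (C : Set (Set E)) (P : Set E) : Prop :=
  IsPolytopalComplex C ∧ ⋃₀ C = P

/-- The graph (`1`-skeleton) of a complex: its vertices are the `0`-dimensional cells, its edges
the `1`-dimensional cells. -/
def complexGraph (C : Set (Set E)) : SimpleGraph {p : E // {p} ∈ C} where
  Adj p q := p ≠ q ∧ segment ℝ (p : E) (q : E) ∈ C
  symm := ⟨fun p q h => ⟨h.1.symm, by rw [segment_symm]; exact h.2⟩⟩
  loopless := ⟨fun _ h => h.1 rfl⟩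

end Polytopes

/-! ### Weak orders -/

section WeakOrders

variable {X : Type*}

/-- A weak order: a transitive and strongly complete binary relation. -/
def IsWeak (W : Set (X × X)) : Prop :=
  (∀ x y z, (x, y) ∈ W → (y, z) ∈ W → (x, z) ∈ W) ∧ ∀ x y, (x, y) ∈ W ∨ (y, x) ∈ W

variable (X) in
/-- The set of all weak orders on `X`, partially ordered by inclusion. -/
abbrev WO : Type _ := {W : Set (X × X) // IsWeak W}

/-- Linear orders: the antisymmetric weak orders. -/
def IsLinear (W : WO X) : Prop :=
  ∀ x y, (x, y) ∈ W.1 → (y, x) ∈ W.1 → x = y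

/-- The indifference relation `W ∩ W⁻¹` of a weak order. -/
def indifference (W : WO X) : Setoid X where
  r x y := (x, y) ∈ W.1 ∧ (y, x) ∈ W.1
  iseqv :=
    { refl := fun x => ⟨(W.2.2 x x).elim id id, (W.2.2 x x).elim id id⟩
      symm := fun h => ⟨h.2, h.1⟩
      trans := fun h h' => ⟨W.2.1 _ _ _ h.1 h'.1, W.2.1 _ _ _ h'.2 h.2⟩ }

/-- A weak `k`-order: a weak order with exactly `k` indifference classes. -/
def IsWeakKOrder (k : ℕ) (W : WO X) : Prop :=
  Nat.card (Quotient (indifference W)) = k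

variable (X) in
/-- The set `WO(2)` of weak `2`-orders. -/
abbrev WO2 : Type _ := {U : WO X // IsWeakKOrder 2 U}

/-- The set `J_W` of all weak `2`-orders containing `W`. -/
def weakTwoOrdersAbove (W : WO X) : Set (WO2 X) :=
  {U | W ≤ U.1}

/-- The characteristic function `χ(J_W)`, a vertex of the cube `[0,1]^d`, `d = |WO(2)|`. -/
noncomputable def charVector (W : WO X) : WO2 X → ℝ :=
  (weakTwoOrdersAbove W).indicator (fun _ => 1)

/-- The cube `conv {χ(J_W) : W ⊇ L}`. -/
noncomputable def woCube (L : WO X) : Set (WO2 X → ℝ) :=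
  convexHull ℝ {p | ∃ W : WO X, L ≤ W ∧ p = charVector W}

variable (X) in
/-- The complex `𝒞(WO)`: all cubes `conv {χ(J_W) : W ⊇ L}`, `L` a linear order, and all
their faces. -/
def woComplex : Set (Set (WO2 X → ℝ)) :=
  {F | ∃ L : WO X, IsLinear L ∧ F ∈ faces (woCube L)}

/-- The weak order represented by a vector: `x` precedes `y` if and only if `v x ≤ v y`. It is
a linear order if the coordinates of `v` are distinct. -/
def weakOrderOf (v : X → ℝ) : WO X :=
  ⟨{p | v p.1 ≤ v p.2}, fun _ _ _ h h1 => le_trans (α := ℝ) h h1, fun x y => le_total (v x) (v y)⟩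

end WeakOrders

/-! ### The permutahedron and its cubes -/

section Permutahedron

variable {X : Type*} [Fintype X]

variable (X) in
/-- The permutahedron `Π_{n-1}`, `n = |X|`: the convex hull in `ℝ^X` of the vectors whose
coordinates are `1, …, n` in some order. -/
def permutahedron : Set (X → ℝ) :=
  convexHull ℝ {v | ∃ e : X ≃ Fin (Fintype.card X), ∀ x, v x = ((e x : ℕ) : ℝ) + 1}

/-- The convex hull `C_v` of the barycenters of all faces of the permutahedron that contain `v`. -/
noncomputable def vertexCube (v : X → ℝ) : Set (X → ℝ) :=
  convexHull ℝ {b | ∃ F ∈ faces (permutahedron X), v ∈ F ∧ b = barycenter F}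

variable (X) in
/-- The collection of all `C_v`, `v` a vertex of the permutahedron, and all their faces. -/
def permutahedronCubes : Set (Set (X → ℝ)) :=
  {F | ∃ v ∈ vertices (permutahedron X), F ∈ faces (vertexCube v)}

theorem vertexCube_mem {v : X → ℝ} (hv : v ∈ vertices (permutahedron X)) :
    vertexCube v ∈ permutahedronCubes X :=
  ⟨v, hv, IsExposed.refl _⟩

end Permutahedron

end WeakOrderComplex

open WeakOrderComplex

namespace WeakOrderComplex

open Set

/-! ### Cubical realizations of a finite poset -/

/-! Both complexes realize one abstract object, the poset of intervals `[V, W]` of `WO X` together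
with an empty interval. A point `x` of either space carries two weak orders `lo x ≤ hi x`, and the
cell of `[V, W]` consists of the points with `V ≤ lo x` and `hi x ≤ W`. The axioms of
`CubicalRealization` are enough to show that the faces of a cell are the cells of the subintervals,
that cells are hulls of the points `point W`, and that the edges are the covering pairs.

In the cube `[0,1]^WO(2)`, `lo` is read off the nonzero coordinates and `hi` off the coordinates
equal to `1`. In the permutahedron, `lo x` is the order of the coordinates of `x`, and `hi x` is the
weak order whose cuts are the tight inequalities `∑ i ∈ s, x i = 1 + ... + |s|`. A tight set has
strictly smaller coordinates than its complement (`lt_of_mem_tightCuts`), whence `lo x ≤ hi x`.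

The cells are cubes because `W ↦ J_W` is injective, reverses the order and has an image closed under
subsets (`isFlagPoset_weakTwoOrdersAbove`): a weak order is a chain of cuts, and any subchain is
again one. So intervals are Boolean. The unit cube is itself a cell of the coordinate realization of
a Boolean lattice, which gives its face lattice. Finally, the equality case of the rearrangement
inequality identifies the barycenters of the faces of the permutahedron with the points of its
realization (`vertexCube_permVec`). -/

/-- A map `J` that represents `Ω`, with its order reversed, as a simplicial complex on `ι`. -/
structure IsFlagPoset {Ω ι : Type*} [PartialOrder Ω] (J : Ω → Set ι) : Prop where
  le_iff : ∀ V W, V ≤ W ↔ J W ⊆ J V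
  exists_eq : ∀ W S, S ⊆ J W → ∃ V, J V = S

namespace IsFlagPoset

variable {Ω ι : Type*} [PartialOrder Ω] {J : Ω → Set ι}

theorem injective (hJ : IsFlagPoset J) : Function.Injective J := fun V W h =>
  le_antisymm ((hJ.le_iff V W).2 h.ge) ((hJ.le_iff W V).2 h.le)

theorem exists_sup (hJ : IsFlagPoset J) (V W : Ω) : ∃ M, ∀ Z, M ≤ Z ↔ V ≤ Z ∧ W ≤ Z := by
  obtain ⟨M, hM⟩ := hJ.exists_eq V (J V ∩ J W) inter_subset_left
  exact ⟨M, fun Z => by rw [hJ.le_iff, hJ.le_iff, hJ.le_iff, hM, subset_inter_iff]⟩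

/-- `J` turns joins into intersections and meets into unions. A union is a value of `J` only if it
lies in some `J Z`, hence the common lower bound. -/
theorem exists_inf (hJ : IsFlagPoset J) {V W Z : Ω} (hV : Z ≤ V) (hW : Z ≤ W) :
    ∃ M, ∀ Z, Z ≤ M ↔ Z ≤ V ∧ Z ≤ W := by
  obtain ⟨M, hM⟩ := hJ.exists_eq Z (J V ∪ J W)
    (union_subset ((hJ.le_iff _ _).1 hV) ((hJ.le_iff _ _).1 hW))
  exact ⟨M, fun Z => by rw [hJ.le_iff, hJ.le_iff, hJ.le_iff, hM, union_subset_iff]⟩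

/-- Every interval is a Boolean lattice. -/
theorem exists_orderEmbedding (hJ : IsFlagPoset J) [Finite ι] {V W : Ω} (h : V ≤ W) :
    ∃ j : (Set (Fin (J V \ J W).ncard))ᵒᵈ ↪o Ω, ∀ Z, Z ∈ range j ↔ V ≤ Z ∧ Z ≤ W := by
  have hWV := (hJ.le_iff _ _).1 h
  let e : Fin (J V \ J W).ncard ≃ ↥(J V \ J W) := (Finite.equivFin _).symm
  -- The interval corresponds to the sets between `J W` and `J V`, that is, to the subsets of the
  -- difference. The order dual appears because `J` reverses inclusion.
  let s : (Set (Fin (J V \ J W).ncard))ᵒᵈ → Set ι :=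
    fun S => J W ∪ (fun k => (e k : ι)) '' OrderDual.ofDual S
  have hs : ∀ S, s S ⊆ J V := by
    rintro S i (hi | ⟨k, -, rfl⟩)
    · exact hWV hi
    · exact (e k).2.1
  choose j hj using fun S => hJ.exists_eq V (s S) (hs S)
  have hmem : ∀ S k, (e k : ι) ∈ s S ↔ k ∈ OrderDual.ofDual S := by
    intro S k
    constructor
    · rintro (hk | ⟨l, hl, hlk⟩)
      · exact ((e k).2.2 hk).elim
      · rwa [← e.injective (Subtype.ext hlk)]
    · exact fun hk => Or.inr ⟨k, hk, rfl⟩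
  refine ⟨OrderEmbedding.ofMapLEIff j fun S T => ?_, fun Z => ?_⟩
  · rw [hJ.le_iff, hj, hj]
    constructor
    · intro hST k hk
      exact (hmem S k).1 (hST ((hmem T k).2 hk))
    · exact fun hST => union_subset_union_right _ (image_mono hST)
  · constructor
    · rintro ⟨S, rfl⟩
      simp only [OrderEmbedding.coe_ofMapLEIff]
      rw [hJ.le_iff, hJ.le_iff, hj]
      exact ⟨hs S, subset_union_left⟩
    · rintro ⟨hVZ, hZW⟩
      rw [hJ.le_iff] at hVZ hZW
      refine ⟨OrderDual.toDual {k | (e k : ι) ∈ J Z}, hJ.injective ?_⟩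
      simp only [OrderEmbedding.coe_ofMapLEIff]
      rw [hj]
      refine Subset.antisymm ?_ fun i hi => ?_
      · rintro i (hi | ⟨k, hk, rfl⟩)
        · exact hZW hi
        · exact hk
      · by_cases hiW : i ∈ J W
        · exact Or.inl hiW
        · refine Or.inr ⟨e.symm ⟨i, hVZ hi, hiW⟩, ?_, by simp⟩
          simpa using hi

end IsFlagPoset

/-- A realization of a finite poset `Ω` in `E` whose cells are indexed by the intervals of `Ω`. A
point `x` of the carrier lies in the relative interior of the cell of `[lo x, hi x]`. -/
structure CubicalRealization (Ω E : Type*) [PartialOrder Ω] [AddCommGroup E] [Module ℝ E]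
    [TopologicalSpace E] where
  carrier : Set E
  lo : E → Ω
  hi : E → Ω
  point : Ω → E
  lo_le_hi : ∀ x ∈ carrier, lo x ≤ hi x
  point_mem : ∀ W, point W ∈ carrier
  lo_point : ∀ W, lo (point W) = W
  hi_point : ∀ W, hi (point W) = W
  convex_star : ∀ W, Convex ℝ {x ∈ carrier | W ≤ lo x}
  isCompact_star : ∀ W, IsCompact {x ∈ carrier | W ≤ lo x}
  -- Relative interiority: a segment from a point `y` of the smallest cell of `x` can be prolonged
  -- beyond `x`.
  exists_extension : ∀ x ∈ carrier, ∀ y ∈ carrier, lo x ≤ lo y → hi y ≤ hi x →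
    ∃ ε : ℝ, 0 < ε ∧ x + ε • (x - y) ∈ carrier ∧ lo x ≤ lo (x + ε • (x - y))
  isExposed_cell : ∀ W V₁ V₂, W ≤ V₁ →
    IsExposed ℝ {x ∈ carrier | W ≤ lo x} {x ∈ carrier | V₁ ≤ lo x ∧ hi x ≤ V₂}
  -- An endpoint of a segment inside a star lies in the smallest cell of each inner point.
  lo_hi_of_mem_openSegment : ∀ W, ∀ x ∈ carrier, ∀ y ∈ carrier, W ≤ lo x → W ≤ lo y →
    ∀ z ∈ openSegment ℝ x y, lo z ≤ lo x ∧ hi x ≤ hi z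

namespace CubicalRealization

variable {Ω E : Type*} [PartialOrder Ω] [AddCommGroup E] [Module ℝ E] [TopologicalSpace E]
  (R : CubicalRealization Ω E)

/-- The union of the cells of the intervals `[V, W]`, `V` fixed. -/
def star (W : Ω) : Set E := {x ∈ R.carrier | W ≤ R.lo x}

/-- The cell of the interval `[V, W]`. -/
def cell (V W : Ω) : Set E := {x ∈ R.carrier | V ≤ R.lo x ∧ R.hi x ≤ W}

variable {R}

theorem point_mem_cell {V W Z : Ω} : R.point Z ∈ R.cell V W ↔ V ≤ Z ∧ Z ≤ W := by
  simp [cell, R.point_mem, R.lo_point, R.hi_point]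

theorem point_injective : Function.Injective R.point := fun V W h => by
  rw [← R.lo_point V, h, R.lo_point]

theorem le_of_mem_cell {V W : Ω} {x : E} (hx : x ∈ R.cell V W) : V ≤ W :=
  hx.2.1.trans ((R.lo_le_hi x hx.1).trans hx.2.2)

theorem mem_cell_self {x : E} (hx : x ∈ R.carrier) : x ∈ R.cell (R.lo x) (R.hi x) :=
  ⟨hx, le_rfl, le_rfl⟩

theorem isExposed_cell_star {W V₁ : Ω} (h : W ≤ V₁) (V₂ : Ω) :
    IsExposed ℝ (R.star W) (R.cell V₁ V₂) :=
  R.isExposed_cell W V₁ V₂ h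

theorem cell_subset_star (V W : Ω) : R.cell V W ⊆ R.star V :=
  (isExposed_cell_star le_rfl W).subset

theorem cell_subset_cell {V W V' W' : Ω} (h : V ≤ W) :
    R.cell V W ⊆ R.cell V' W' ↔ V' ≤ V ∧ W ≤ W' := by
  constructor
  · intro hs
    exact ⟨(point_mem_cell.1 (hs (point_mem_cell.2 ⟨le_rfl, h⟩))).1,
      (point_mem_cell.1 (hs (point_mem_cell.2 ⟨h, le_rfl⟩))).2⟩
  · rintro ⟨h1, h2⟩ x ⟨hx, hx1, hx2⟩
    exact ⟨hx, h1.trans hx1, hx2.trans h2⟩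

theorem cell_mem_faces {V W V' W' : Ω} (h : V ≤ V') (h' : W' ≤ W) :
    R.cell V' W' ∈ faces (R.cell V W) :=
  (isExposed_cell_star h W').mono (cell_subset_star V W)
    fun _ hx => ⟨hx.1, h.trans hx.2.1, hx.2.2.trans h'⟩

theorem exists_mem_openSegment {V : Ω} {x y : E} (hx : x ∈ R.star V) (hy : y ∈ R.carrier)
    (h : R.lo x ≤ R.lo y) (h' : R.hi y ≤ R.hi x) :
    ∃ z ∈ R.star V, x ∈ openSegment ℝ y z := by
  obtain ⟨ε, hε, hz, hlo⟩ := R.exists_extension x hx.1 y hy h h'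
  refine ⟨_, ⟨hz, hx.2.trans hlo⟩, ε / (1 + ε), 1 / (1 + ε), by positivity, by positivity, ?_, ?_⟩
  · field_simp
    ring
  · have h1 : (1 + ε) ≠ 0 := by positivity
    match_scalars
    · field_simp
      ring
    · field_simp

theorem convex_cell (V W : Ω) : Convex ℝ (R.cell V W) :=
  (isExposed_cell_star le_rfl W).convex (R.convex_star V)

/-- Choose `c` in `F` with the largest possible interval. The midpoint of `c` and any `y ∈ F` has an
interval containing both of theirs, so by maximality `y` lies in the cell of `c`. Conversely, `c` is
an inner point of a segment from any point of its cell, and `F` is extreme. -/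
theorem exists_eq_cell_of_mem_faces [Finite Ω] {V W : Ω} {F : Set E}
    (hF : F ∈ faces (R.cell V W)) (hne : F.Nonempty) :
    ∃ V' W', V ≤ V' ∧ V' ≤ W' ∧ W' ≤ W ∧ F = R.cell V' W' := by
  have hF' : IsExposed ℝ (R.cell V W) F := hF
  have hsub := hF'.subset
  have hconv := hF'.convex (convex_cell V W)
  have hext : IsExtreme ℝ (R.star V) F :=
    (isExposed_cell_star le_rfl W).isExtreme.trans hF'.isExtreme
  obtain ⟨c, hc, hmin⟩ := exists_minimalFor_of_wellFoundedLT (· ∈ F)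
    (fun x => (R.lo x, OrderDual.toDual (R.hi x))) hne
  have hcG := hsub hc
  refine ⟨R.lo c, R.hi c, hcG.2.1, R.lo_le_hi c hcG.1, hcG.2.2, Subset.antisymm ?_ ?_⟩
  · intro y hy
    have hyG := hsub hy
    let z := (1 / 2 : ℝ) • c + (1 / 2 : ℝ) • y
    have hz : z ∈ openSegment ℝ c y :=
      ⟨1 / 2, 1 / 2, by norm_num, by norm_num, by norm_num, rfl⟩
    have hzF : z ∈ F := hconv.segment_subset hc hy (openSegment_subset_segment ℝ c y hz)
    have h1 := R.lo_hi_of_mem_openSegment V c hcG.1 y hyG.1 hcG.2.1 hyG.2.1 z hz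
    have h2 := R.lo_hi_of_mem_openSegment V y hyG.1 c hcG.1 hyG.2.1 hcG.2.1 z
      (openSegment_symm ℝ c y ▸ hz)
    have h3 := hmin hzF (show (R.lo z, OrderDual.toDual (R.hi z)) ≤
      (R.lo c, OrderDual.toDual (R.hi c)) from ⟨h1.1, h1.2⟩)
    exact ⟨hyG.1, h3.1.trans h2.1, h2.2.trans h3.2⟩
  · intro y hy
    obtain ⟨z, hz, hcz⟩ := exists_mem_openSegment (V := V) ⟨hcG.1, hcG.2.1⟩ hy.1 hy.2.1 hy.2.2
    exact hext.left_mem_of_mem_openSegment ⟨hy.1, hcG.2.1.trans hy.2.1⟩ hz hc hcz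

theorem mem_faces_cell_iff [Finite Ω] {V W : Ω} {F : Set E} :
    F ∈ faces (R.cell V W) ↔
      F = ∅ ∨ ∃ V' W', V ≤ V' ∧ V' ≤ W' ∧ W' ≤ W ∧ F = R.cell V' W' := by
  constructor
  · intro hF
    rcases F.eq_empty_or_nonempty with rfl | hne
    · exact Or.inl rfl
    · exact Or.inr (exists_eq_cell_of_mem_faces hF hne)
  · rintro (rfl | ⟨V', W', h1, -, h2, rfl⟩)
    · exact isExposed_empty
    · exact cell_mem_faces h1 h2

section Topology

variable [IsTopologicalAddGroup E] [ContinuousSMul ℝ E] [T2Space E] [LocallyConvexSpace ℝ E]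
  [Finite Ω]

/-- By Krein–Milman it suffices to find the extreme points. Such an `x` is an inner point of a
segment starting at `point (lo x)`, hence equal to it. The other end is only known to lie in the
star, so extremality is used there. -/
theorem cell_eq_convexHull (V W : Ω) :
    R.cell V W = convexHull ℝ (R.point '' Icc V W) := by
  refine Subset.antisymm ?_ (convexHull_min ?_ (convex_cell V W))
  · have hcomp : IsCompact (R.cell V W) :=
      (isExposed_cell_star le_rfl W).isCompact (R.isCompact_star V)
    rw [← closure_convexHull_extremePoints hcomp (convex_cell V W)]
    refine closure_minimal (convexHull_mono ?_) (((toFinite _).image _).isClosed_convexHull ℝ)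
    intro x hx
    have hxc : x ∈ R.cell V W := hx.1
    have hx' := (isExposed_cell_star (R := R) (le_refl V) W).isExtreme
      |>.extremePoints_subset_extremePoints hx
    have hp : V ≤ R.lo x ∧ R.lo x ≤ W := ⟨hxc.2.1, (R.lo_le_hi x hxc.1).trans hxc.2.2⟩
    obtain ⟨z, hz, hxz⟩ := exists_mem_openSegment (V := V) ⟨hxc.1, hxc.2.1⟩
      (R.point_mem (R.lo x)) (R.lo_point _).ge
      ((R.hi_point _).le.trans (R.lo_le_hi x hxc.1))
    exact ⟨R.lo x, hp, hx'.2 ⟨R.point_mem _, hp.1.trans (R.lo_point _).ge⟩ hz hxz⟩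
  · rintro _ ⟨Z, hZ, rfl⟩
    exact point_mem_cell.2 hZ

theorem isPolytope_cell (V W : Ω) : IsPolytope (R.cell V W) :=
  ⟨_, (toFinite _).image _, cell_eq_convexHull V W⟩

theorem cell_self (W : Ω) : R.cell W W = {R.point W} := by
  rw [cell_eq_convexHull, Icc_self, image_singleton, convexHull_singleton]

end Topology

theorem nonempty_cell {V W : Ω} (h : V ≤ W) : (R.cell V W).Nonempty :=
  ⟨R.point V, point_mem_cell.2 ⟨le_rfl, h⟩⟩

/-- Serves twice: with `j` the identity for the whole complex, and with `j` the embedding of a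
Boolean lattice for the faces of one cell. -/
theorem exists_intervalOrderIso {Ω' : Type*} [PartialOrder Ω'] (j : Ω' ↪o Ω) {K : Set (Set E)}
    (hK : ∀ F, F ∈ K ↔ F = ∅ ∨ ∃ a b, a ≤ b ∧ F = R.cell (j a) (j b)) :
    ∃ φ : Interval Ω' ≃o K, ∀ I : NonemptyInterval Ω',
      (φ (I : Interval Ω') : Set E) = R.cell (j I.fst) (j I.snd) := by
  let f : Interval Ω' → K := WithBot.recBotCoe ⟨∅, (hK _).2 (Or.inl rfl)⟩
    fun I => ⟨R.cell (j I.fst) (j I.snd), (hK _).2 (Or.inr ⟨_, _, I.fst_le_snd, rfl⟩)⟩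
  have hf : ∀ I I', f I ≤ f I' ↔ I ≤ I' := by
    intro I I'
    induction I using WithBot.recBotCoe with
    | bot => exact iff_of_true (empty_subset _) bot_le
    | coe I =>
      induction I' using WithBot.recBotCoe with
      | bot =>
        refine iff_of_false (fun h => ?_) (WithBot.not_coe_le_bot _)
        exact (nonempty_cell (j.monotone I.fst_le_snd)).ne_empty (subset_empty_iff.1 h)
      | coe I' =>
        refine (cell_subset_cell (j.monotone I.fst_le_snd)).trans
          (Iff.trans ?_ WithBot.coe_le_coe.symm)
        rw [NonemptyInterval.le_def, j.le_iff_le, j.le_iff_le]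
  refine ⟨RelIso.ofSurjective (OrderEmbedding.ofMapLEIff f hf) ?_, fun I => rfl⟩
  rintro ⟨F, hF⟩
  rcases (hK F).1 hF with rfl | ⟨a, b, hab, rfl⟩
  · exact ⟨⊥, rfl⟩
  · exact ⟨((⟨(a, b), hab⟩ : NonemptyInterval Ω') : Interval Ω'), rfl⟩

variable (R) in
/-- The complex of all cells. -/
def complex : Set (Set E) := {F | F = ∅ ∨ ∃ V W, V ≤ W ∧ F = R.cell V W}

theorem complex_eq [Finite Ω] [OrderTop Ω] {base : Ω → Prop} (hbase : ∀ W, ∃ L, base L ∧ L ≤ W) :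
    {F | ∃ L, base L ∧ F ∈ faces (R.cell L ⊤)} = R.complex := by
  ext F
  simp only [mem_ofPred_eq, mem_faces_cell_iff, complex]
  constructor
  · rintro ⟨L, -, rfl | ⟨V, W, -, h, -, rfl⟩⟩
    · exact Or.inl rfl
    · exact Or.inr ⟨V, W, h, rfl⟩
  · rintro (rfl | ⟨V, W, h, rfl⟩)
    · obtain ⟨L, hL, -⟩ := hbase ⊤
      exact ⟨L, hL, Or.inl rfl⟩
    · obtain ⟨L, hL, hLV⟩ := hbase V
      exact ⟨L, hL, Or.inr ⟨V, W, hLV, h, le_top, rfl⟩⟩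

theorem cell_mem_complex (V W : Ω) : R.cell V W ∈ R.complex := by
  rcases (R.cell V W).eq_empty_or_nonempty with h | ⟨x, hx⟩
  · exact Or.inl h
  · exact Or.inr ⟨V, W, le_of_mem_cell hx, rfl⟩

theorem exists_complexOrderIso : ∃ φ : Interval Ω ≃o R.complex, ∀ I : NonemptyInterval Ω,
    (φ (I : Interval Ω) : Set E) = R.cell I.fst I.snd :=
  exists_intervalOrderIso (RelEmbedding.refl _) fun _ => Iff.rfl

theorem sUnion_complex : ⋃₀ R.complex = R.carrier := by
  refine Subset.antisymm (sUnion_subset ?_) fun x hx => ⟨_, cell_mem_complex _ _, mem_cell_self hx⟩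
  rintro F (rfl | ⟨V, W, -, rfl⟩) x hx
  · exact hx.elim
  · exact hx.1

theorem exists_faces_cell_orderIso [Finite Ω] {Ω' : Type*} [PartialOrder Ω'] {V W : Ω}
    (j : Ω' ↪o Ω) (hj : ∀ Z, Z ∈ range j ↔ V ≤ Z ∧ Z ≤ W) :
    Nonempty (Interval Ω' ≃o faces (R.cell V W)) := by
  refine ⟨(exists_intervalOrderIso (R := R) j fun F => mem_faces_cell_iff.trans ?_).choose⟩
  refine or_congr Iff.rfl ⟨?_, ?_⟩
  · rintro ⟨V', W', h1, h2, h3, rfl⟩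
    obtain ⟨a, rfl⟩ := (hj V').2 ⟨h1, h2.trans h3⟩
    obtain ⟨b, rfl⟩ := (hj W').2 ⟨h1.trans h2, h3⟩
    exact ⟨a, b, j.le_iff_le.1 h2, rfl⟩
  · rintro ⟨a, b, hab, rfl⟩
    exact ⟨_, _, ((hj _).1 ⟨a, rfl⟩).1, j.monotone hab, ((hj _).1 ⟨b, rfl⟩).2, rfl⟩

/-- At `point Z` both `lo` and `hi` equal `Z`, so an endpoint in its smallest cell coincides with
it. -/
theorem eq_or_eq_of_point_mem_segment {A V W Z : Ω} (hV : A ≤ V) (hW : A ≤ W)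
    (h : R.point Z ∈ segment ℝ (R.point V) (R.point W)) : Z = V ∨ Z = W := by
  rw [← insert_endpoints_openSegment] at h
  rcases h with h | h | h
  · exact Or.inl (point_injective h)
  · exact Or.inr (point_injective h)
  · have := R.lo_hi_of_mem_openSegment A _ (R.point_mem V) _ (R.point_mem W) (by rwa [R.lo_point])
      (by rwa [R.lo_point]) _ h
    rw [R.lo_point, R.lo_point, R.hi_point, R.hi_point] at this
    exact Or.inl (this.1.antisymm this.2)

section Topology

variable [IsTopologicalAddGroup E] [ContinuousSMul ℝ E] [T2Space E] [LocallyConvexSpace ℝ E]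
  [Finite Ω]

theorem isPolytopalComplex {ι : Type*} {J : Ω → Set ι} (hJ : IsFlagPoset J) :
    IsPolytopalComplex R.complex where
  finite := by
    refine (finite_range fun p : Option (Ω × Ω) => p.elim ∅ fun p => R.cell p.1 p.2).subset ?_
    rintro F (rfl | ⟨V, W, -, rfl⟩)
    · exact ⟨none, rfl⟩
    · exact ⟨some (V, W), rfl⟩
  isPolytope := by
    rintro F (rfl | ⟨V, W, -, rfl⟩)
    · exact ⟨∅, finite_empty, convexHull_empty.symm⟩
    · exact isPolytope_cell V W
  empty_mem := Or.inl rfl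
  face_mem := by
    rintro F (rfl | ⟨V, W, -, rfl⟩) G hG
    · exact Or.inl (subset_empty_iff.1 (IsExposed.subset hG))
    · rcases mem_faces_cell_iff.1 hG with rfl | ⟨V', W', -, -, -, rfl⟩
      · exact Or.inl rfl
      · exact cell_mem_complex _ _
  inter_mem := by
    rintro F (rfl | ⟨V, W, -, rfl⟩) G (rfl | ⟨V', W', -, rfl⟩)
    iterate 3 simp only [empty_inter, inter_empty]; exact ⟨isExposed_empty, isExposed_empty⟩
    rcases (R.cell V W ∩ R.cell V' W').eq_empty_or_nonempty with h | ⟨x, hx, hx'⟩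
    · rw [h]
      exact ⟨isExposed_empty, isExposed_empty⟩
    -- Cells intersect as intervals do. The meet of `W` and `W'` exists because `hi x` lies below
    -- both.
    · obtain ⟨M, hM⟩ := hJ.exists_sup V V'
      obtain ⟨N, hN⟩ := hJ.exists_inf hx.2.2 hx'.2.2
      have : R.cell V W ∩ R.cell V' W' = R.cell M N := by
        ext y
        simp only [cell, mem_inter_iff, mem_ofPred_eq, hM, hN]
        tauto
      rw [this]
      obtain ⟨h1, h2⟩ := (hM M).1 le_rfl
      obtain ⟨h3, h4⟩ := (hN N).1 le_rfl
      exact ⟨cell_mem_faces h1 h3, cell_mem_faces h2 h4⟩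

theorem singleton_mem_complex {p : E} : {p} ∈ R.complex ↔ ∃ W, R.point W = p := by
  constructor
  · rintro (h | ⟨V, W, h, hp⟩)
    · exact (singleton_ne_empty p h).elim
    · have : R.point V ∈ ({p} : Set E) := hp ▸ point_mem_cell.2 ⟨le_rfl, h⟩
      exact ⟨V, this⟩
  · rintro ⟨W, rfl⟩
    rw [← cell_self]
    exact cell_mem_complex _ _

/-- If the segment is the cell of `[A, B]`, then every element of `[A, B]` gives a point on it,
hence is `V` or `W`. -/
theorem segment_mem_complex {V W : Ω} (hne : V ≠ W) :
    segment ℝ (R.point V) (R.point W) ∈ R.complex ↔ V ⋖ W ∨ W ⋖ V := by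
  have key : ∀ {V W : Ω}, V ⋖ W → segment ℝ (R.point V) (R.point W) ∈ R.complex := by
    intro V W h
    rw [← convexHull_pair, ← image_pair, ← h.Icc_eq, ← cell_eq_convexHull]
    exact cell_mem_complex _ _
  constructor
  · rintro (h | ⟨A, B, hAB, h⟩)
    · exact ((h ▸ left_mem_segment ℝ _ _ : R.point V ∈ (∅ : Set E))).elim
    · have hV := point_mem_cell.1 (h ▸ left_mem_segment ℝ (R.point V) (R.point W))
      have hW := point_mem_cell.1 (h ▸ right_mem_segment ℝ (R.point V) (R.point W))
      have hZ : ∀ Z, A ≤ Z → Z ≤ B → Z = V ∨ Z = W := fun Z h1 h2 =>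
        eq_or_eq_of_point_mem_segment hV.1 hW.1 (h ▸ point_mem_cell.2 ⟨h1, h2⟩)
      rcases hZ A le_rfl hAB with rfl | rfl
      · refine Or.inl ⟨lt_of_le_of_ne hW.1 hne, fun Z h1 h2 => ?_⟩
        rcases hZ Z h1.le (h2.le.trans hW.2) with rfl | rfl
        · exact h1.false
        · exact h2.false
      · refine Or.inr ⟨lt_of_le_of_ne hV.1 hne.symm, fun Z h1 h2 => ?_⟩
        rcases hZ Z h1.le (h2.le.trans hV.2) with rfl | rfl
        · exact h2.false
        · exact h1.false
  · rintro (h | h)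
    · exact key h
    · rw [segment_symm]
      exact key h

variable (R) in
theorem nonempty_complexGraph_iso : Nonempty (complexGraph R.complex ≃g SimpleGraph.hasse Ω) := by
  let f : Ω → {p : E // {p} ∈ R.complex} := fun W => ⟨R.point W, singleton_mem_complex.2 ⟨W, rfl⟩⟩
  have hf : Function.Bijective f := by
    constructor
    · intro V W h
      exact point_injective (congrArg Subtype.val h)
    · rintro ⟨p, hp⟩
      obtain ⟨W, rfl⟩ := singleton_mem_complex.1 hp
      exact ⟨W, rfl⟩
  refine ⟨(SimpleGraph.Iso.symm ⟨Equiv.ofBijective f hf, fun {V W} => ?_⟩)⟩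
  change (f V ≠ f W ∧ segment ℝ (R.point V) (R.point W) ∈ R.complex) ↔ _
  rw [SimpleGraph.hasse_adj, hf.1.ne_iff]
  by_cases h : V = W
  · simp [h]
  · rw [segment_mem_complex h]
    simp [h]

end Topology

end CubicalRealization

/-! ### Finite systems of linear inequalities -/

/-- Constraints that are slack at `a` survive a small step by continuity; tight ones stay tight
because `b` is tight there too. -/
theorem exists_pos_forall_extension_nonneg {κ : Type*} [Finite κ] {a b : κ → ℝ} (ha : ∀ k, 0 ≤ a k)
    (hab : ∀ k, a k = 0 → b k = 0) : ∃ ε : ℝ, 0 < ε ∧ ∀ k, 0 ≤ a k + ε * (a k - b k) := by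
  have : ∀ᶠ ε : ℝ in nhdsWithin 0 (Ioi 0), ∀ k, 0 ≤ a k + ε * (a k - b k) := by
    refine Filter.eventually_all.2 fun k => ?_
    rcases (ha k).eq_or_lt with h | h
    · simp [← h, hab k h.symm]
    · have hc : Filter.Tendsto (fun ε : ℝ => a k + ε * (a k - b k)) (nhdsWithin 0 (Ioi 0))
          (nhds (a k + 0 * (a k - b k))) :=
        (Continuous.tendsto (by fun_prop) 0).mono_left nhdsWithin_le_nhds
      rw [zero_mul, add_zero] at hc
      exact (hc.eventually (lt_mem_nhds h)).mono fun _ h => h.le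
  obtain ⟨ε, h, hε⟩ := (this.and self_mem_nhdsWithin).exists
  exact ⟨ε, hε, h⟩

theorem isExposed_of_forall_eq_zero {E κ : Type*} [AddCommGroup E] [Module ℝ E]
    [TopologicalSpace E] [IsTopologicalAddGroup E] [ContinuousSMul ℝ E] [Finite κ] {A B : Set E}
    (l : κ → StrongDual ℝ E) (c : κ → ℝ) (hA : ∀ x ∈ A, ∀ k, c k ≤ l k x)
    (hB : B = {x ∈ A | ∀ k, l k x = c k}) : IsExposed ℝ A B := by
  have := Fintype.ofFinite κ
  rintro ⟨b, hb⟩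
  have hval : ∀ x, (-∑ k, l k) x = -∑ k, l k x := fun x => by simp
  -- The sum of the `l k` is at least the sum of the `c k`, with equality only if every constraint
  -- is tight. The point `b` shows that the bound is attained.
  refine ⟨-∑ k, l k, ?_⟩
  rw [hB] at hb ⊢
  ext x
  simp only [mem_ofPred_eq, hval, neg_le_neg_iff]
  refine and_congr_right fun hx => ⟨fun h y hy => ?_, fun h => ?_⟩
  · exact Finset.sum_le_sum fun k _ => (h k).trans_le (hA y hy k)
  · have h1 := h b hb.1
    have h2 : ∑ k, l k b = ∑ k, c k := Finset.sum_congr rfl fun k _ => hb.2 k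
    have h3 : ∑ k, c k = ∑ k, l k x :=
      le_antisymm (Finset.sum_le_sum fun k _ => hA x hx k) (h1.trans_eq h2)
    exact fun k =>
      ((Finset.sum_eq_sum_iff_of_le fun k _ => hA x hx k).1 h3 k (Finset.mem_univ k)).symm

/-! ### The realization by coordinate faces of the unit cube -/

namespace IsFlagPoset

variable {Ω ι : Type*} [PartialOrder Ω] {J : Ω → Set ι}

/-- The element of `Ω` represented by a set. -/
noncomputable def ofSet [Nonempty Ω] (J : Ω → Set ι) (S : Set ι) : Ω :=
  Classical.epsilon fun W => J W = S

theorem map_ofSet [Nonempty Ω] (hJ : IsFlagPoset J) {W : Ω} {S : Set ι} (h : S ⊆ J W) :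
    J (ofSet J S) = S :=
  Classical.epsilon_spec (p := fun W => J W = S) (hJ.exists_eq W S h)

theorem ofSet_map [Nonempty Ω] (hJ : IsFlagPoset J) (W : Ω) : ofSet J (J W) = W :=
  hJ.injective (hJ.map_ofSet Subset.rfl)

theorem le_ofSet_iff [Nonempty Ω] (hJ : IsFlagPoset J) {V W : Ω} {S : Set ι} (h : S ⊆ J V) :
    W ≤ ofSet J S ↔ S ⊆ J W := by
  rw [hJ.le_iff, hJ.map_ofSet h]

theorem ofSet_le_iff [Nonempty Ω] (hJ : IsFlagPoset J) {V W : Ω} {S : Set ι} (h : S ⊆ J V) :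
    ofSet J S ≤ W ↔ J W ⊆ S := by
  rw [hJ.le_iff, hJ.map_ofSet h]

/-- The realization of `Ω` by coordinate faces of the unit cube. -/
noncomputable def coordinate [Finite ι] [Nonempty Ω] (hJ : IsFlagPoset J) :
    CubicalRealization Ω (ι → ℝ) := by
  classical
  let _ := Fintype.ofFinite ι
  -- A star is a product of unit intervals and zeros, so it is convex and compact.
  have hstar : ∀ W, {x | x ∈ {x : ι → ℝ | (∀ i, x i ∈ Icc (0 : ℝ) 1) ∧
      ∃ W, {i | x i ≠ 0} ⊆ J W} ∧ W ≤ ofSet J {i | x i ≠ 0}} =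
      univ.pi fun i => if i ∈ J W then Icc (0 : ℝ) 1 else {0} := by
    intro W
    ext x
    simp only [mem_ofPred_eq, mem_univ_pi]
    constructor
    · rintro ⟨⟨h, V, hV⟩, hW⟩ i
      rw [hJ.le_ofSet_iff hV] at hW
      split_ifs with hi
      · exact h i
      · by_contra h0
        exact hi (hW h0)
    · intro h
      have hW : {i | x i ≠ 0} ⊆ J W := by
        intro i hi
        by_contra hiW
        have := h i
        rw [if_neg hiW] at this
        exact hi this
      refine ⟨⟨fun i => ?_, W, hW⟩, (hJ.le_ofSet_iff hW).2 hW⟩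
      have := h i
      split_ifs at this
      · exact this
      · rw [mem_singleton_iff.1 this]
        simp
  have hle : ∀ {x : ι → ℝ} {W}, {i | x i ≠ 0} ⊆ J W → {i | x i = 1} ⊆ J W := by
    intro x W h i hi
    refine h ?_
    simp only [mem_ofPred_eq] at hi ⊢
    simp [hi]
  have hind1 : ∀ W, {i | (J W).indicator (fun _ => (1 : ℝ)) i ≠ 0} = J W := fun W => by
    ext i; simp
  have hind2 : ∀ W, {i | (J W).indicator (fun _ => (1 : ℝ)) i = 1} = J W := fun W => by
    ext i; simp [indicator_apply]
  exact
  { carrier := {x | (∀ i, x i ∈ Icc (0 : ℝ) 1) ∧ ∃ W, {i | x i ≠ 0} ⊆ J W}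
    lo := fun x => ofSet J {i | x i ≠ 0}
    hi := fun x => ofSet J {i | x i = 1}
    point := fun W => (J W).indicator fun _ => 1
    lo_le_hi := by
      rintro x ⟨-, W, hW⟩
      rw [hJ.le_iff, hJ.map_ofSet hW, hJ.map_ofSet (hle hW)]
      intro i hi
      simp only [mem_ofPred_eq] at hi ⊢
      simp [hi]
    point_mem := fun W => by
      refine ⟨fun i => ?_, W, (hind1 W).le⟩
      rw [indicator_apply]
      split_ifs <;> simp
    lo_point := fun W => by rw [hind1, hJ.ofSet_map]
    hi_point := fun W => by rw [hind2, hJ.ofSet_map]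
    convex_star := fun W => by
      rw [hstar]
      refine convex_pi fun i _ => ?_
      split_ifs
      · exact convex_Icc 0 1
      · exact convex_singleton 0
    isCompact_star := fun W => by
      rw [hstar]
      refine isCompact_univ_pi fun i => ?_
      split_ifs
      · exact isCompact_Icc
      · exact isCompact_singleton
    exists_extension := by
      rintro x ⟨hx, V, hV⟩ y ⟨hy, V', hV'⟩ h1 h2
      rw [hJ.le_iff, hJ.map_ofSet hV, hJ.map_ofSet hV'] at h1
      rw [hJ.le_iff, hJ.map_ofSet (hle hV), hJ.map_ofSet (hle hV')] at h2
      have hxy : ∀ i, x i = 0 → y i = 0 := fun i hi => by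
        by_contra hne
        exact h1 hne hi
      obtain ⟨ε, hε, h⟩ := exists_pos_forall_extension_nonneg (κ := ι ⊕ ι)
        (a := Sum.elim x fun i => 1 - x i) (b := Sum.elim y fun i => 1 - y i)
        (by
          rintro (i | i)
          · exact (hx i).1
          · exact sub_nonneg.2 (hx i).2)
        (by
          rintro (i | i) hi
          · exact hxy i hi
          · exact sub_eq_zero.2 (h2 (sub_eq_zero.1 hi).symm).symm)
      -- The support does not grow, so the new point stays in the carrier.
      have hs : {i | (x + ε • (x - y)) i ≠ 0} ⊆ {i | x i ≠ 0} := by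
        intro i hi h0
        exact hi (by simp [h0, hxy i h0])
      refine ⟨ε, hε, ⟨fun i => ⟨?_, ?_⟩, V, hs.trans hV⟩, ?_⟩
      · simpa using h (Sum.inl i)
      · have := h (Sum.inr i)
        simp only [Sum.elim_inr] at this
        simp only [Pi.add_apply, Pi.smul_apply, Pi.sub_apply, smul_eq_mul]
        linarith
      · rw [hJ.le_iff, hJ.map_ofSet hV, hJ.map_ofSet (hs.trans hV)]
        exact hs
    isExposed_cell := by
      intro W V₁ V₂ hW
      have hW' := (hJ.le_iff _ _).1 hW
      -- The equations of the cell are `x i = 0` off `J V₁` and `x i = 1` on `J V₂`; the other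
      -- indices get the zero functional.
      refine isExposed_of_forall_eq_zero (κ := ι ⊕ ι)
        (Sum.elim (fun i => if i ∈ J V₁ then 0 else ContinuousLinearMap.proj i)
          (fun i => if i ∈ J V₂ then -ContinuousLinearMap.proj i else 0))
        (Sum.elim 0 fun i => if i ∈ J V₂ then -1 else 0) ?_ ?_
      · rintro x ⟨⟨hx, -⟩, -⟩ (i | i)
        · simp only [Sum.elim_inl]
          split_ifs
          · simp
          · exact (hx i).1
        · simp only [Sum.elim_inr]
          split_ifs
          · simpa using (hx i).2
          · simp
      · ext x
        simp only [mem_ofPred_eq, Sum.forall, Sum.elim_inl, Sum.elim_inr, and_assoc]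
        refine and_congr_right fun hx => ⟨?_, ?_⟩
        · rintro ⟨⟨V, hV⟩, h1, h2⟩
          refine ⟨⟨V, hV⟩, hW.trans h1, fun i => ?_, fun i => ?_⟩
          · rw [hJ.le_ofSet_iff hV] at h1
            split_ifs with hi
            · simp
            · by_contra h0
              exact hi (h1 h0)
          · rw [hJ.ofSet_le_iff (hle hV)] at h2
            split_ifs with hi
            · simpa using h2 hi
            · simp
        · rintro ⟨⟨V, hV⟩, h0, h1, h2⟩
          refine ⟨⟨V, hV⟩, (hJ.le_ofSet_iff hV).2 fun i hi => ?_,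
            (hJ.ofSet_le_iff (hle hV)).2 fun i hi => ?_⟩
          · by_contra hiV
            have := h1 i
            rw [if_neg hiV] at this
            exact hi this
          · have := h2 i
            rw [if_pos hi, if_pos hi] at this
            simpa using this
    lo_hi_of_mem_openSegment := by
      rintro W x ⟨hx, V, hV⟩ y ⟨hy, V', hV'⟩ h1 h2 z ⟨a, b, ha, hb, hab, rfl⟩
      have h3 : {i | (a • x + b • y) i ≠ 0} ⊆ J W := by
        rw [hJ.le_ofSet_iff hV] at h1
        rw [hJ.le_ofSet_iff hV'] at h2
        intro i hi
        by_contra hiW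
        have hx0 : x i = 0 := by
          by_contra h
          exact hiW (h1 h)
        have hy0 : y i = 0 := by
          by_contra h
          exact hiW (h2 h)
        exact hi (by simp [hx0, hy0])
      rw [hJ.ofSet_le_iff h3, hJ.map_ofSet hV, hJ.le_ofSet_iff (hle h3), hJ.map_ofSet (hle hV)]
      refine ⟨fun i hi => ?_, fun i hi => ?_⟩
      · have h4 : 0 < x i := lt_of_le_of_ne (hx i).1 (Ne.symm hi)
        have h5 := (hy i).1
        have : 0 < a * x i + b * y i := by positivity
        exact this.ne'
      · have hi' : a * x i + b * y i = 1 := hi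
        have h4 := (hx i).2
        have h5 := (hy i).2
        by_contra h6
        have h7 : x i < 1 := lt_of_le_of_ne h4 h6
        nlinarith [mul_lt_mul_of_pos_left h7 ha, mul_le_mul_of_nonneg_left h5 hb.le] }

variable [Finite ι] [Nonempty Ω] (hJ : IsFlagPoset J)

@[simp]
theorem coordinate_carrier : hJ.coordinate.carrier =
    {x | (∀ i, x i ∈ Icc (0 : ℝ) 1) ∧ ∃ W, {i | x i ≠ 0} ⊆ J W} := rfl

theorem ofDual (κ : Type*) : IsFlagPoset (fun S : (Set κ)ᵒᵈ => OrderDual.ofDual S) where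
  le_iff _ _ := Iff.rfl
  exists_eq _ S _ := ⟨OrderDual.toDual S, rfl⟩

/-- The unit cube is the cell of `[⊥, ⊤]` in the coordinate realization of the Boolean lattice. -/
theorem nonempty_interval_orderIso_faces_unitCube (m : ℕ) :
    Nonempty (Interval (Set (Fin m))ᵒᵈ ≃o faces (Icc (0 : Fin m → ℝ) 1)) := by
  have h : (ofDual (Fin m)).coordinate.cell ⊥ ⊤ = Icc (0 : Fin m → ℝ) 1 := by
    ext x
    simp only [CubicalRealization.cell, coordinate_carrier, bot_le, le_top, and_self, and_true,
      mem_ofPred_eq, mem_Icc, Pi.le_def, Pi.zero_apply, Pi.one_apply]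
    exact ⟨fun h => ⟨fun i => (h.1 i).1, fun i => (h.1 i).2⟩,
      fun h => ⟨fun i => ⟨h.1 i, h.2 i⟩, OrderDual.toDual univ, subset_univ _⟩⟩
  rw [← h]
  exact CubicalRealization.exists_faces_cell_orderIso (RelEmbedding.refl _) (by simp)

end IsFlagPoset

namespace CubicalRealization

variable {Ω ι E : Type*} [PartialOrder Ω] [AddCommGroup E] [Module ℝ E] [TopologicalSpace E]
  {R : CubicalRealization Ω E} [IsTopologicalAddGroup E] [ContinuousSMul ℝ E] [T2Space E]
  [LocallyConvexSpace ℝ E] [Finite Ω] [Finite ι] {J : Ω → Set ι}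

theorem isCombinatorialCube_cell (hJ : IsFlagPoset J) {V W : Ω} (h : V ≤ W) :
    IsCombinatorialCube (J V \ J W).ncard (R.cell V W) := by
  refine ⟨isPolytope_cell V W, ?_⟩
  obtain ⟨j, hj⟩ := hJ.exists_orderEmbedding h
  obtain ⟨φ⟩ := exists_faces_cell_orderIso (R := R) j hj
  obtain ⟨ψ⟩ := IsFlagPoset.nonempty_interval_orderIso_faces_unitCube (J V \ J W).ncard
  exact ⟨φ.symm.trans ψ⟩

theorem isCubicalComplex (hJ : IsFlagPoset J) : IsCubicalComplex R.complex := by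
  refine ⟨isPolytopalComplex hJ, ?_⟩
  rintro P (rfl | ⟨V, W, h, rfl⟩) hP
  · exact (not_nonempty_empty hP).elim
  · exact ⟨_, isCombinatorialCube_cell hJ h⟩

end CubicalRealization

/-! ### The flag structure of weak orders -/

section WeakOrders

variable {X : Type*}

theorem WO.refl (W : WO X) (x : X) : (x, x) ∈ W.1 := (W.2.2 x x).elim id id

theorem WO.trans (W : WO X) {x y z : X} : (x, y) ∈ W.1 → (y, z) ∈ W.1 → (x, z) ∈ W.1 :=
  W.2.1 x y z

theorem WO.le_def {V W : WO X} : V ≤ W ↔ ∀ x y, (x, y) ∈ V.1 → (x, y) ∈ W.1 :=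
  ⟨fun h _ _ hxy => h hxy, fun h p hp => h p.1 p.2 hp⟩

instance : OrderTop (WO X) where
  top := ⟨univ, fun _ _ _ _ _ => trivial, fun _ _ => Or.inl trivial⟩
  le_top W := subset_univ W.1

theorem mem_of_not_mem_of_le {V W : WO X} (h : V ≤ W) {x y : X} (hxy : (x, y) ∉ W.1) :
    (y, x) ∈ V.1 :=
  (V.2.2 x y).resolve_left fun h' => hxy (h h')

/-- Two lower sets of a weak order are comparable. -/
theorem subset_or_subset_of_lower {W : WO X} {s t : Finset X}
    (hs : ∀ x y, (x, y) ∈ W.1 → y ∈ s → x ∈ s) (ht : ∀ x y, (x, y) ∈ W.1 → y ∈ t → x ∈ t) :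
    s ⊆ t ∨ t ⊆ s := by
  by_contra! h
  obtain ⟨⟨a, ha, ha'⟩, b, hb, hb'⟩ := And.imp Finset.not_subset.1 Finset.not_subset.1 h
  rcases W.2.2 a b with hab | hba
  · exact ha' (ht _ _ hab hb)
  · exact hb' (hs _ _ hba ha)

theorem WO.exists_max (W : WO X) {s : Finset X} (hs : s.Nonempty) :
    ∃ a ∈ s, ∀ x ∈ s, (x, a) ∈ W.1 := by
  classical
  induction hs using Finset.Nonempty.cons_induction with
  | singleton a => exact ⟨a, by simp, by simp [W.refl]⟩
  | cons a s ha hs ih =>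
    obtain ⟨b, hb, h⟩ := ih
    rcases W.2.2 a b with hab | hba
    · refine ⟨b, by simp [hb], fun x hx => ?_⟩
      rcases Finset.mem_cons.1 hx with rfl | hx
      exacts [hab, h x hx]
    · refine ⟨a, by simp, fun x hx => ?_⟩
      rcases Finset.mem_cons.1 hx with rfl | hx
      exacts [W.refl _, W.trans (h x hx) hba]

theorem WO.exists_min (W : WO X) {s : Finset X} (hs : s.Nonempty) :
    ∃ a ∈ s, ∀ x ∈ s, (a, x) ∈ W.1 := by
  obtain ⟨a, ha, h⟩ := WO.exists_max ⟨{p | (p.2, p.1) ∈ W.1}, fun x y z h1 h2 => W.trans h2 h1,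
    fun x y => W.2.2 y x⟩ hs
  exact ⟨a, ha, h⟩

variable [Fintype X]

open Classical in
/-- The lower indifference class of a weak `2`-order. -/
noncomputable def cut (U : WO2 X) : Finset X :=
  Finset.univ.filter fun x => ∃ y, (y, x) ∉ U.1.1

/-- If `y` is strictly below `x` and `x` is in the lower class, some `z` is strictly above `x`,
giving three classes. -/
theorem mem_iff_cut (U : WO2 X) {x y : X} : (x, y) ∈ U.1.1 ↔ (y ∈ cut U → x ∈ cut U) := by
  simp only [cut, Finset.mem_filter_univ]
  constructor
  · rintro hxy ⟨z, hz⟩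
    exact ⟨z, fun hzx => hz (U.1.trans hzx hxy)⟩
  · intro h
    by_contra hxy
    obtain ⟨z, hz⟩ := h ⟨x, hxy⟩
    obtain ⟨p, q, -, hpq⟩ := Nat.card_eq_two_iff.1 U.2
    have hp : ∀ r : Quotient (indifference U.1), r = p ∨ r = q := fun r => by
      have : r ∈ ({p, q} : Set _) := hpq ▸ mem_univ r
      exact this
    have hyx := mem_of_not_mem_of_le le_rfl hxy
    have hxz := mem_of_not_mem_of_le le_rfl hz
    have h1 : (Quotient.mk (indifference U.1) x) ≠ Quotient.mk _ y := fun h =>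
      hxy (Quotient.exact h).1
    have h2 : (Quotient.mk (indifference U.1) x) ≠ Quotient.mk _ z := fun h =>
      hz (Quotient.exact h).2
    have h3 : (Quotient.mk (indifference U.1) y) ≠ Quotient.mk _ z := fun h =>
      hz (U.1.trans (Quotient.exact h).2 hyx)
    rcases hp (Quotient.mk _ x) with hx | hx <;> rcases hp (Quotient.mk _ y) with hy | hy <;>
      rcases hp (Quotient.mk _ z) with hz | hz <;> simp_all

theorem le_iff_cut {W : WO X} {U : WO2 X} :
    W ≤ U.1 ↔ ∀ x y, (x, y) ∈ W.1 → y ∈ cut U → x ∈ cut U := by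
  simp only [WO.le_def, mem_iff_cut]

theorem cut_injective : Function.Injective (cut (X := X)) := fun U V h => by
  refine Subtype.ext (Subtype.ext ?_)
  ext ⟨x, y⟩
  rw [mem_iff_cut, mem_iff_cut, h]

theorem cut_nonempty_and_ne_univ (U : WO2 X) : (cut U).Nonempty ∧ cut U ≠ Finset.univ := by
  obtain ⟨p, q, hne, -⟩ := Nat.card_eq_two_iff.1 U.2
  induction p using Quotient.inductionOn with | _ a
  induction q using Quotient.inductionOn with | _ b
  have key : ∀ a b, (a, b) ∉ U.1.1 → (cut U).Nonempty ∧ cut U ≠ Finset.univ := by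
    intro a b hab
    rw [mem_iff_cut, Classical.not_imp] at hab
    exact ⟨⟨b, hab.1⟩, fun h => hab.2 (h ▸ Finset.mem_univ a)⟩
  by_cases hab : (a, b) ∈ U.1.1
  · exact key b a fun hba => hne (Quotient.sound ⟨hab, hba⟩)
  · exact key a b hab

/-- With `cut_injective` and `cut_nonempty_and_ne_univ`, this identifies weak `2`-orders with
nonempty proper subsets. -/
theorem exists_cut_eq {s : Finset X} (h : s.Nonempty) (h' : s ≠ Finset.univ) :
    ∃ U : WO2 X, cut U = s := by
  obtain ⟨a, ha⟩ := h
  obtain ⟨b, hb⟩ : ∃ b, b ∉ s := by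
    by_contra! hs
    exact h' (Finset.eq_univ_of_forall hs)
  let W : WO X := ⟨{p | p.2 ∈ s → p.1 ∈ s}, fun x y z h1 h2 h3 => h1 (h2 h3), fun x y => by
    by_cases hx : x ∈ s
    · exact Or.inl fun _ => hx
    · exact Or.inr fun h => (hx h).elim⟩
  have hW : IsWeakKOrder 2 W := by
    refine Nat.card_eq_two_iff.2 ⟨Quotient.mk _ a, Quotient.mk _ b, fun h => ?_, ?_⟩
    · exact hb ((Quotient.exact h).2 ha)
    · refine eq_univ_of_forall fun r => ?_
      induction r using Quotient.inductionOn with | _ x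
      by_cases hx : x ∈ s
      · exact Or.inl (Quotient.sound ⟨fun _ => hx, fun _ => ha⟩)
      · exact Or.inr (Quotient.sound ⟨fun h => (hb h).elim, fun h => (hx h).elim⟩)
  refine ⟨⟨W, hW⟩, ?_⟩
  ext x
  simp only [cut, Finset.mem_filter_univ]
  constructor
  · rintro ⟨y, hy⟩
    exact (Classical.not_imp.1 hy).1
  · exact fun hx => ⟨b, fun h => hb (h hx)⟩

/-- A nonempty proper lower set of a weak order is the cut of a weak `2`-order above it. -/
theorem exists_mem_weakTwoOrdersAbove {W : WO X} {s : Finset X} (h : s.Nonempty)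
    (h' : s ≠ Finset.univ) (hs : ∀ x y, (x, y) ∈ W.1 → y ∈ s → x ∈ s) :
    ∃ U ∈ weakTwoOrdersAbove W, cut U = s := by
  obtain ⟨U, rfl⟩ := exists_cut_eq h h'
  exact ⟨U, le_iff_cut.2 hs, rfl⟩

/-- A separated pair is separated by a weak `2`-order. -/
theorem exists_cut_separating {W : WO X} {x y : X} (h : (x, y) ∉ W.1) :
    ∃ U ∈ weakTwoOrdersAbove W, y ∈ cut U ∧ x ∉ cut U := by
  classical
  obtain ⟨U, hU, hs⟩ := exists_mem_weakTwoOrdersAbove (W := W)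
    (s := Finset.univ.filter fun z => (z, y) ∈ W.1) ⟨y, by simp [W.refl]⟩
    (fun hu => h (by simpa using Finset.ext_iff.1 hu x))
    (fun a b hab hb => by simpa using W.trans hab (by simpa using hb))
  exact ⟨U, hU, by simp [hs, W.refl], by simpa [hs] using h⟩

theorem isFlagPoset_weakTwoOrdersAbove : IsFlagPoset (weakTwoOrdersAbove (X := X)) where
  le_iff V W := by
    refine ⟨fun h U hU => h.trans hU, fun h => WO.le_def.2 fun x y hxy => ?_⟩
    by_contra hxy'
    obtain ⟨U, hU, hy, hx⟩ := exists_cut_separating hxy'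
    exact hx (le_iff_cut.1 (h hU) x y hxy hy)
  exists_eq W S hS := by
    -- The largest relation respecting all cuts in `S`. It is complete because `W` is and respects
    -- them too.
    let V : WO X := ⟨{p | ∀ U ∈ S, p.2 ∈ cut U → p.1 ∈ cut U},
      fun x y z h1 h2 U hU hz => h1 U hU (h2 U hU hz), fun x y => by
        rcases W.2.2 x y with h | h
        · exact Or.inl fun U hU => le_iff_cut.1 (hS hU) x y h
        · exact Or.inr fun U hU => le_iff_cut.1 (hS hU) y x h⟩
    refine ⟨V, Subset.antisymm (fun U hU => ?_) fun U hU =>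
      le_iff_cut.2 fun x y h => h U hU⟩
    have hlow := le_iff_cut.1 hU
    classical
    obtain ⟨hne, hne'⟩ := cut_nonempty_and_ne_univ U
    -- A cut in `S` that separates the top `a` of `cut U` from the bottom `b` of its complement must
    -- equal `cut U`.
    obtain ⟨a, ha, hmax⟩ := V.exists_max hne
    obtain ⟨b, hb, hmin⟩ := V.exists_min (s := (cut U)ᶜ)
      (Finset.nonempty_iff_ne_empty.2 fun h => hne' (Finset.compl_eq_empty_iff _ |>.1 h))
    rw [Finset.mem_compl] at hb
    have hba : (b, a) ∉ V.1 := fun h => hb (hlow b a h ha)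
    have : ∃ T ∈ S, a ∈ cut T ∧ b ∉ cut T := by
      by_contra! h
      exact hba fun T hT haT => h T hT haT
    obtain ⟨T, hT, haT, hbT⟩ := this
    have hTU : cut T = cut U := by
      ext x
      constructor
      · intro hx
        by_contra hxU
        exact hbT (hmin x (Finset.mem_compl.2 hxU) T hT hx)
      · exact fun hx => hmax x hx T hT haT
    exact cut_injective hTU ▸ hT

/-- Every weak order contains a linear order, which may be prescribed on one pair. -/
theorem exists_isLinear_le (W : WO X) {a b : X} (hab : (a, b) ∈ W.1) :
    ∃ L : WO X, IsLinear L ∧ L ≤ W ∧ (a, b) ∈ L.1 := by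
  -- Ties of `W` are broken by an injective `f`; an enumeration or its negative puts `a` before `b`.
  have key : ∀ f : X → ℤ, Function.Injective f → f a ≤ f b →
      ∃ L : WO X, IsLinear L ∧ L ≤ W ∧ (a, b) ∈ L.1 := by
    intro f hf hfab
    refine ⟨⟨{p | (p.1, p.2) ∈ W.1 ∧ ((p.2, p.1) ∈ W.1 → f p.1 ≤ f p.2)}, ?_, ?_⟩, ?_, ?_, ?_⟩
    · rintro x y z ⟨h1, h2⟩ ⟨h3, h4⟩
      exact ⟨W.trans h1 h3, fun h => (h2 (W.trans h3 h)).trans (h4 (W.trans h h1))⟩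
    · intro x y
      simp only [mem_ofPred_eq]
      by_cases hxy : (x, y) ∈ W.1
      · by_cases hyx : (y, x) ∈ W.1
        · rcases le_total (f x) (f y) with h | h
          · exact Or.inl ⟨hxy, fun _ => h⟩
          · exact Or.inr ⟨hyx, fun _ => h⟩
        · exact Or.inl ⟨hxy, fun h => (hyx h).elim⟩
      · exact Or.inr ⟨(W.2.2 x y).resolve_left hxy, fun h => (hxy h).elim⟩
    · rintro x y ⟨h1, h2⟩ ⟨h3, h4⟩
      exact hf (le_antisymm (h2 h3) (h4 h1))
    · exact fun p hp => hp.1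
    · exact ⟨hab, fun _ => hfab⟩
  let e := Fintype.equivFin X
  have he : Function.Injective fun x => ((e x : ℕ) : ℤ) := fun x y h =>
    e.injective (Fin.ext (Int.ofNat_inj.1 h))
  rcases le_total ((e a : ℕ) : ℤ) (e b : ℕ) with h | h
  · exact key _ he h
  · exact key (fun x => -((e x : ℕ) : ℤ)) (neg_injective.comp he) (neg_le_neg h)

theorem exists_isLinear_le' (W : WO X) : ∃ L : WO X, IsLinear L ∧ L ≤ W := by
  rcases isEmpty_or_nonempty X with h | ⟨⟨a⟩⟩
  · exact ⟨W, fun x => isEmptyElim x, le_rfl⟩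
  · obtain ⟨L, h1, h2, -⟩ := exists_isLinear_le W (W.refl a)
    exact ⟨L, h1, h2⟩

theorem exists_equiv_fin_of_isLinear {L : WO X} (hL : IsLinear L) :
    ∃ e : X ≃ Fin (Fintype.card X), ∀ x y, (x, y) ∈ L.1 ↔ e x ≤ e y := by
  let _ : LinearOrder X :=
    { le := fun x y => (x, y) ∈ L.1
      le_refl := L.refl
      le_trans := fun _ _ _ => L.trans
      le_antisymm := hL
      le_total := L.2.2
      toDecidableLE := Classical.decRel _ }
  let e := Fintype.orderIsoFinOfCardEq X rfl
  exact ⟨e.symm.toEquiv, fun x y => (e.symm.le_iff_le (x := x) (y := y)).symm⟩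

theorem sum_filter_lt {M : Type*} [AddCommMonoid M] (e : X ≃ Fin (Fintype.card X)) (f : ℕ → M)
    {k : ℕ} (hk : k ≤ Fintype.card X) :
    ∑ x with (e x : ℕ) < k, f (e x) = ∑ i ∈ Finset.range k, f i := by
  refine Finset.sum_nbij (fun x => (e x : ℕ)) (fun x hx => by simpa using hx)
    (fun x _ y _ h => e.injective (Fin.ext h)) (fun i hi => ?_) fun _ _ => rfl
  have hi : i < k := by simpa using hi
  exact ⟨e.symm ⟨i, hi.trans_le hk⟩, by simpa using hi, by simp⟩

theorem card_filter_lt (e : X ≃ Fin (Fintype.card X)) {k : ℕ} (hk : k ≤ Fintype.card X) :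
    (Finset.univ.filter fun x => (e x : ℕ) < k).card = k := by
  simpa using sum_filter_lt e (fun _ => (1 : ℕ)) hk

/-- Lower sets are nested, so their size determines them. -/
theorem eq_filter_lt_of_lower {L : WO X} {e : X ≃ Fin (Fintype.card X)}
    (he : ∀ x y, (x, y) ∈ L.1 ↔ e x ≤ e y) {s : Finset X}
    (hs : ∀ x y, (x, y) ∈ L.1 → y ∈ s → x ∈ s) :
    s = Finset.univ.filter fun x => (e x : ℕ) < s.card := by
  have hc := card_filter_lt e s.card_le_univ
  rcases subset_or_subset_of_lower (W := L) hs
    (t := Finset.univ.filter fun x => (e x : ℕ) < s.card) (fun x y hxy hy => by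
      simp only [Finset.mem_filter_univ] at hy ⊢
      exact (Fin.le_def.1 ((he x y).1 hxy)).trans_lt hy) with h | h
  · exact Finset.eq_of_subset_of_card_le h hc.le
  · exact (Finset.eq_of_subset_of_card_le h hc.ge).symm

/-- The cuts are the initial segments, one of each size from `1` to `n - 1`. -/
theorem ncard_weakTwoOrdersAbove_of_isLinear {L : WO X} (hL : IsLinear L) :
    (weakTwoOrdersAbove L).ncard = Fintype.card X - 1 := by
  obtain ⟨e, he⟩ := exists_equiv_fin_of_isLinear hL
  have hinj : InjOn (fun U => (cut U).card) (weakTwoOrdersAbove L) := by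
    intro U hU V hV h
    refine cut_injective ?_
    rw [eq_filter_lt_of_lower he (le_iff_cut.1 hU), eq_filter_lt_of_lower he (le_iff_cut.1 hV)]
    simp only at h
    rw [h]
  have himage : (fun U => (cut U).card) '' weakTwoOrdersAbove L =
      Finset.Ico 1 (Fintype.card X) := by
    ext k
    simp only [mem_image, Finset.coe_Ico, mem_Ico]
    constructor
    · rintro ⟨U, -, rfl⟩
      obtain ⟨h1, h2⟩ := cut_nonempty_and_ne_univ U
      exact ⟨h1.card_pos, (Finset.card_lt_iff_ne_univ _).2 h2⟩
    · rintro ⟨h1, h2⟩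
      have hc := card_filter_lt e h2.le
      obtain ⟨U, hU, hs⟩ := exists_mem_weakTwoOrdersAbove (W := L)
        (s := Finset.univ.filter fun x => (e x : ℕ) < k) (Finset.card_pos.1 (by omega))
        ((Finset.card_lt_iff_ne_univ _).1 (by omega)) (fun x y hxy hy => by
          simp only [Finset.mem_filter_univ] at hy ⊢
          exact (Fin.le_def.1 ((he x y).1 hxy)).trans_lt hy)
      exact ⟨U, hU, by rw [hs, hc]⟩
  rw [← hinj.ncard_image, himage, ncard_coe_finset, Nat.card_Ico]

theorem weakTwoOrdersAbove_top : weakTwoOrdersAbove (⊤ : WO X) = ∅ := by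
  refine eq_empty_of_forall_notMem fun U hU => ?_
  obtain ⟨⟨a, ha⟩, h⟩ := cut_nonempty_and_ne_univ U
  exact h (Finset.eq_univ_of_forall fun x => le_iff_cut.1 hU x a trivial ha)

end WeakOrders

/-! ### The permutahedron -/

section Permutahedron

variable {X : Type*}

theorem sum_add_smul (s : Finset X) (a b : ℝ) (x y : X → ℝ) :
    ∑ i ∈ s, (a • x + b • y) i = a * ∑ i ∈ s, x i + b * ∑ i ∈ s, y i := by
  simp [Finset.sum_add_distrib, Finset.mul_sum]

variable [Fintype X]

/-- The vertex of the permutahedron given by an enumeration of `X`. -/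
def permVec (e : X ≃ Fin (Fintype.card X)) : X → ℝ := fun x => ((e x : ℕ) : ℝ) + 1

theorem permVec_le_iff (e : X ≃ Fin (Fintype.card X)) {x y : X} :
    permVec e x ≤ permVec e y ↔ e x ≤ e y := by
  simp [permVec]

theorem permVec_injective : Function.Injective (permVec (X := X)) := fun e f h => by
  ext x
  have := congrFun h x
  simpa [permVec] using this

theorem permutahedron_eq : permutahedron X = convexHull ℝ (range permVec) := by
  unfold permutahedron
  congr 1
  ext v
  exact ⟨fun ⟨e, he⟩ => ⟨e, funext fun x => (he x).symm⟩, fun ⟨e, he⟩ => ⟨e, fun x => he ▸ rfl⟩⟩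

theorem permVec_mem (e : X ≃ Fin (Fintype.card X)) : permVec e ∈ permutahedron X := by
  rw [permutahedron_eq]
  exact subset_convexHull ℝ _ ⟨e, rfl⟩

theorem isLinear_weakOrderOf_permVec (e : X ≃ Fin (Fintype.card X)) :
    IsLinear (weakOrderOf (permVec e)) := fun _ _ h h' =>
  e.injective (le_antisymm ((permVec_le_iff e).1 h) ((permVec_le_iff e).1 h'))

theorem exists_weakOrderOf_permVec_eq {L : WO X} (hL : IsLinear L) :
    ∃ e : X ≃ Fin (Fintype.card X), weakOrderOf (permVec e) = L := by
  obtain ⟨e, he⟩ := exists_equiv_fin_of_isLinear hL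
  refine ⟨e, Subtype.ext (Set.ext fun p => ?_)⟩
  exact (permVec_le_iff e).trans (he p.1 p.2).symm

/-- The minimal sum of `k` coordinates of a point of the permutahedron. -/
def minSum (k : ℕ) : ℝ := ∑ i ∈ Finset.range k, ((i : ℝ) + 1)

@[simp] theorem minSum_zero : minSum 0 = 0 := by simp [minSum]

theorem minSum_succ (k : ℕ) : minSum (k + 1) = minSum k + (k + 1) := by
  simp [minSum, Finset.sum_range_succ]

theorem minSum_le_sum_permVec (e : X ≃ Fin (Fintype.card X)) (s : Finset X) :
    minSum s.card ≤ ∑ x ∈ s, permVec e x := by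
  have hinj : Function.Injective fun x => ((e x : ℕ) : ℤ) + 1 := fun x y h =>
    e.injective (Fin.ext (by simpa using h))
  have h := Finset.sum_range_le_sum (s := s.map ⟨_, hinj⟩) (c := 1) (by simp)
  simp only [Finset.card_map, Finset.sum_map, Function.Embedding.coeFn_mk] at h
  have h' : ((∑ n ∈ Finset.range s.card, (1 + (n : ℤ)) : ℤ) : ℝ) ≤
    ((∑ x ∈ s, (((e x : ℕ) : ℤ) + 1) : ℤ) : ℝ) := by exact_mod_cast h
  push_cast at h'
  simpa [minSum, permVec, add_comm] using h'

theorem sum_permVec_of_lower (e : X ≃ Fin (Fintype.card X)) {s : Finset X}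
    (hs : ∀ x y, (x, y) ∈ (weakOrderOf (permVec e)).1 → y ∈ s → x ∈ s) :
    ∑ x ∈ s, permVec e x = minSum s.card := by
  rw [eq_filter_lt_of_lower (L := weakOrderOf (permVec e)) (fun _ _ => permVec_le_iff e) hs,
    card_filter_lt e s.card_le_univ]
  exact sum_filter_lt e (fun i => (i : ℝ) + 1) s.card_le_univ

variable (X) in
/-- The polyhedron cut out by the inequalities of the permutahedron. -/
def permutahedronRegion : Set (X → ℝ) :=
  {x | (∀ s : Finset X, minSum s.card ≤ ∑ i ∈ s, x i) ∧ ∑ i, x i = minSum (Fintype.card X)}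

theorem permVec_mem_region (e : X ≃ Fin (Fintype.card X)) :
    permVec e ∈ permutahedronRegion X :=
  ⟨minSum_le_sum_permVec e, sum_permVec_of_lower e fun _ _ _ _ => Finset.mem_univ _⟩

theorem convex_permutahedronRegion : Convex ℝ (permutahedronRegion X) := by
  rintro x ⟨hx, hx'⟩ y ⟨hy, hy'⟩ a b ha hb hab
  refine ⟨fun s => ?_, ?_⟩
  · rw [sum_add_smul]
    calc minSum s.card = a * minSum s.card + b * minSum s.card := by rw [← add_mul, hab, one_mul]
      _ ≤ _ := add_le_add (mul_le_mul_of_nonneg_left (hx s) ha)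
        (mul_le_mul_of_nonneg_left (hy s) hb)
  · rw [sum_add_smul, hx', hy', ← add_mul, hab, one_mul]

theorem permutahedron_subset_region : permutahedron X ⊆ permutahedronRegion X := by
  rw [permutahedron_eq]
  refine convexHull_min ?_ convex_permutahedronRegion
  rintro _ ⟨e, rfl⟩
  exact permVec_mem_region e

theorem one_le_of_mem_region {x : X → ℝ} (hx : x ∈ permutahedronRegion X) (i : X) : 1 ≤ x i := by
  simpa [minSum] using hx.1 {i}

/-- The weak `2`-orders whose inequality is tight at a point. -/
def tightCuts (x : X → ℝ) : Set (WO2 X) := {U | ∑ i ∈ cut U, x i = minSum (cut U).card}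

/-- Let `k` be the size of the cut. Removing `a` gives `x a ≤ k`; adding `b` gives `x b ≥ k + 1`. -/
theorem lt_of_mem_tightCuts {x : X → ℝ} (hx : x ∈ permutahedronRegion X) {U : WO2 X}
    (hU : U ∈ tightCuts x) {a b : X} (ha : a ∈ cut U) (hb : b ∉ cut U) : x a < x b := by
  classical
  have h : ∑ i ∈ cut U, x i = minSum (cut U).card := hU
  have h1 := hx.1 ((cut U).erase a)
  have h2 := hx.1 (insert b (cut U))
  rw [Finset.sum_insert hb, Finset.card_insert_of_notMem hb, h, minSum_succ] at h2
  rw [← Finset.add_sum_erase _ _ ha, ← Finset.card_erase_add_one ha, minSum_succ] at h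
  have h3 : ((((cut U).erase a).card : ℕ) : ℝ) + 1 = (cut U).card := by
    exact_mod_cast Finset.card_erase_add_one ha
  linarith

theorem tightCuts_subset {x : X → ℝ} (hx : x ∈ permutahedronRegion X) :
    tightCuts x ⊆ weakTwoOrdersAbove (weakOrderOf x) := fun U hU => by
  refine le_iff_cut.2 fun a b hab hb => ?_
  by_contra ha
  exact (lt_of_mem_tightCuts hx hU hb ha).not_ge hab

theorem tightCuts_permVec (e : X ≃ Fin (Fintype.card X)) :
    tightCuts (permVec e) = weakTwoOrdersAbove (weakOrderOf (permVec e)) :=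
  Subset.antisymm (tightCuts_subset (permVec_mem_region e)) fun _ hU =>
    sum_permVec_of_lower e (le_iff_cut.1 hU)

/-! ### Averages of compatible vertices -/

open Classical in
/-- The enumerations of `X` that are compatible with a weak order. -/
noncomputable def compatible (W : WO X) : Finset (X ≃ Fin (Fintype.card X)) :=
  Finset.univ.filter fun e => weakOrderOf (permVec e) ≤ W

theorem mem_compatible {W : WO X} {e : X ≃ Fin (Fintype.card X)} :
    e ∈ compatible W ↔ weakOrderOf (permVec e) ≤ W := by
  simp [compatible]

theorem compatible_nonempty (W : WO X) : (compatible W).Nonempty := by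
  obtain ⟨L, hL, hLW⟩ := exists_isLinear_le' W
  obtain ⟨e, rfl⟩ := exists_weakOrderOf_permVec_eq hL
  exact ⟨e, mem_compatible.2 hLW⟩

/-- The average of the vertices of the permutahedron that are compatible with a weak order. -/
noncomputable def averageVertex (W : WO X) : X → ℝ :=
  ((compatible W).card : ℝ)⁻¹ • ∑ e ∈ compatible W, permVec e

theorem card_compatible_pos (W : WO X) : (0 : ℝ) < (compatible W).card :=
  Nat.cast_pos.2 (compatible_nonempty W).card_pos

theorem averageVertex_apply (W : WO X) (x : X) : averageVertex W x =
    ((compatible W).card : ℝ)⁻¹ * ∑ e ∈ compatible W, permVec e x := by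
  simp [averageVertex]

theorem sum_averageVertex (W : WO X) (s : Finset X) : ∑ i ∈ s, averageVertex W i =
    ((compatible W).card : ℝ)⁻¹ * ∑ e ∈ compatible W, ∑ i ∈ s, permVec e i := by
  simp only [averageVertex_apply, ← Finset.mul_sum]
  rw [Finset.sum_comm]

theorem averageVertex_mem (W : WO X) : averageVertex W ∈ permutahedron X := by
  have : averageVertex W = (compatible W).centerMass (fun _ => (1 : ℝ)) permVec := by
    simp [averageVertex, Finset.centerMass]
  rw [this, permutahedron_eq]
  exact Finset.centerMass_mem_convexHull _ (fun _ _ => zero_le_one)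
    (by simpa using card_compatible_pos W) fun e _ => ⟨e, rfl⟩

/-- Strict preferences hold at every compatible vertex, hence on average. Swapping two indifferent
elements permutes the compatible enumerations, so their averages agree. -/
theorem weakOrderOf_averageVertex (W : WO X) : weakOrderOf (averageVertex W) = W := by
  classical
  have hlt : ∀ x y, (y, x) ∉ W.1 → averageVertex W x < averageVertex W y := by
    intro x y h
    rw [averageVertex_apply, averageVertex_apply]
    refine mul_lt_mul_of_pos_left (Finset.sum_lt_sum_of_nonempty (compatible_nonempty W)
      fun e he => ?_) (inv_pos.2 (card_compatible_pos W))
    by_contra! hle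
    exact h (mem_compatible.1 he hle)
  have heq : ∀ x y, (x, y) ∈ W.1 → (y, x) ∈ W.1 → averageVertex W x = averageVertex W y := by
    intro x y hxy hyx
    have hσ : ∀ a, (a, Equiv.swap x y a) ∈ W.1 ∧ (Equiv.swap x y a, a) ∈ W.1 := by
      intro a
      rw [Equiv.swap_apply_def]
      split_ifs with h h
      · subst h; exact ⟨hxy, hyx⟩
      · subst h; exact ⟨hyx, hxy⟩
      · exact ⟨W.refl a, W.refl a⟩
    have hmem : ∀ e ∈ compatible W, (Equiv.swap x y).trans e ∈ compatible W := by
      intro e he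
      refine mem_compatible.2 fun p hp => ?_
      have : (Equiv.swap x y p.1, Equiv.swap x y p.2) ∈ W.1 := mem_compatible.1 he hp
      exact W.trans (hσ p.1).1 (W.trans this (hσ p.2).2)
    rw [averageVertex_apply, averageVertex_apply]
    congr 1
    refine Finset.sum_nbij' (fun e => (Equiv.swap x y).trans e)
      (fun e => (Equiv.swap x y).trans e) hmem hmem ?_ ?_ ?_
    · intro e _; ext; simp
    · intro e _; ext; simp
    · intro e _; simp [permVec]
  refine Subtype.ext (Set.ext fun ⟨x, y⟩ => ⟨fun h => ?_, fun h => ?_⟩)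
  · by_contra hxy
    exact (hlt y x hxy).not_ge h
  · by_cases hyx : (y, x) ∈ W.1
    · exact (heq x y h hyx).le
    · exact (hlt x y hyx).le

theorem tightCuts_averageVertex (W : WO X) :
    tightCuts (averageVertex W) = weakTwoOrdersAbove W := by
  refine Subset.antisymm ?_ fun U hU => ?_
  · have h := tightCuts_subset (permutahedron_subset_region (averageVertex_mem W))
    rwa [weakOrderOf_averageVertex] at h
  · have h : ∀ e ∈ compatible W, ∑ i ∈ cut U, permVec e i = minSum (cut U).card := by
      intro e he
      have : U ∈ tightCuts (permVec e) := by
        rw [tightCuts_permVec]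
        exact (mem_compatible.1 he).trans hU
      exact this
    change ∑ i ∈ cut U, averageVertex W i = _
    rw [sum_averageVertex, Finset.sum_congr rfl h, Finset.sum_const, nsmul_eq_mul,
      inv_mul_cancel_left₀ (card_compatible_pos W).ne']

variable (X) in
/-- The realization of the weak orders by the barycentric cubes of the permutahedron. -/
noncomputable def permutahedronRealization : CubicalRealization (WO X) (X → ℝ) where
  carrier := permutahedronRegion X
  lo := weakOrderOf
  hi x := IsFlagPoset.ofSet weakTwoOrdersAbove (tightCuts x)
  point := averageVertex
  lo_le_hi x hx :=
    (isFlagPoset_weakTwoOrdersAbove.le_ofSet_iff (tightCuts_subset hx)).2 (tightCuts_subset hx)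
  point_mem W := permutahedron_subset_region (averageVertex_mem W)
  lo_point := weakOrderOf_averageVertex
  hi_point W := by
    rw [tightCuts_averageVertex, isFlagPoset_weakTwoOrdersAbove.ofSet_map]
  convex_star W := by
    rintro x ⟨hx, hx'⟩ y ⟨hy, hy'⟩ a b ha hb hab
    refine ⟨convex_permutahedronRegion hx hy ha hb hab, fun p hp => ?_⟩
    exact add_le_add (mul_le_mul_of_nonneg_left (hx' hp) ha) (mul_le_mul_of_nonneg_left (hy' hp) hb)
  isCompact_star W := by
    have h : {x | x ∈ permutahedronRegion X ∧ W ≤ weakOrderOf x} =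
        ((⋂ s : Finset X, {x : X → ℝ | minSum s.card ≤ ∑ i ∈ s, x i}) ∩
          {x : X → ℝ | ∑ i, x i = minSum (Fintype.card X)}) ∩
          ⋂ p ∈ W.1, {x : X → ℝ | x p.1 ≤ x p.2} := by
      ext x
      simp only [mem_inter_iff, mem_iInter]
      rfl
    -- All coordinates are at least `1`, so each is at most the total.
    refine (isCompact_univ_pi (s := fun _ : X => Icc (1 : ℝ) (minSum (Fintype.card X)))
      fun _ => isCompact_Icc).of_isClosed_subset ?_ ?_
    · rw [h]
      refine ((isClosed_iInter fun s => ?_).inter ?_).inter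
        (isClosed_biInter fun p _ => isClosed_le (by fun_prop) (by fun_prop))
      · exact isClosed_le (by fun_prop) (by fun_prop)
      · exact isClosed_eq (by fun_prop) (by fun_prop)
    · rintro x ⟨hx, -⟩ i -
      have h1 := one_le_of_mem_region hx
      refine ⟨h1 i, ?_⟩
      rw [← hx.2]
      exact Finset.single_le_sum (fun j _ => zero_le_one.trans (h1 j)) (Finset.mem_univ i)
  exists_extension := by
    intro x hx y hy h1 h2
    rw [isFlagPoset_weakTwoOrdersAbove.le_iff,
      isFlagPoset_weakTwoOrdersAbove.map_ofSet (tightCuts_subset hx),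
      isFlagPoset_weakTwoOrdersAbove.map_ofSet (tightCuts_subset hy)] at h2
    -- Cuts account for the nonempty proper sets; for the other two, equality holds on the whole
    -- region.
    have htight : ∀ s : Finset X, ∑ i ∈ s, x i = minSum s.card →
        ∑ i ∈ s, y i = minSum s.card := by
      intro s hs
      rcases s.eq_empty_or_nonempty with rfl | hne
      · simp
      · by_cases hu : s = Finset.univ
        · rw [hu]
          exact hy.2
        · obtain ⟨U, rfl⟩ := exists_cut_eq hne hu
          exact h2 hs
    obtain ⟨ε, hε, h⟩ := exists_pos_forall_extension_nonneg
      (κ := Finset X ⊕ (weakOrderOf x).1)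
      (a := Sum.elim (fun s => ∑ i ∈ s, x i - minSum s.card) fun p => x p.1.2 - x p.1.1)
      (b := Sum.elim (fun s => ∑ i ∈ s, y i - minSum s.card) fun p => y p.1.2 - y p.1.1)
      (by
        rintro (s | p)
        · exact sub_nonneg.2 (hx.1 s)
        · exact sub_nonneg.2 p.2)
      (by
        rintro (s | p) hp
        · exact sub_eq_zero.2 (htight s (sub_eq_zero.1 hp))
        · have hp' : x p.1.2 ≤ x p.1.1 := (sub_eq_zero.1 hp).le
          have h3 : y p.1.1 ≤ y p.1.2 := h1 p.2
          have h4 : y p.1.2 ≤ y p.1.1 := h1 (show (p.1.2, p.1.1) ∈ (weakOrderOf x).1 from hp')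
          exact sub_eq_zero.2 (h4.antisymm h3))
    have hsum : ∀ s : Finset X, ∑ i ∈ s, (x + ε • (x - y)) i =
        ∑ i ∈ s, x i + ε * (∑ i ∈ s, x i - ∑ i ∈ s, y i) := fun s => by
      simp [Finset.sum_add_distrib, Finset.mul_sum, mul_sub]
    refine ⟨ε, hε, ⟨fun s => ?_, ?_⟩, fun p hp => ?_⟩
    · have := h (Sum.inl s)
      simp only [Sum.elim_inl] at this
      rw [hsum]
      linarith
    · rw [hsum, hx.2, hy.2]
      simp
    · have := h (Sum.inr ⟨p, hp⟩)
      simp only [Sum.elim_inr] at this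
      change x p.1 + ε * (x p.1 - y p.1) ≤ x p.2 + ε * (x p.2 - y p.2)
      linarith
  isExposed_cell := by
    intro W V₁ V₂ hW
    -- On the star of `W`, the condition `V₁ ≤ lo x` turns into equality on the pairs of `W`
    -- reversed in `V₁`, and `hi x ≤ V₂` says that the cuts above `V₂` are tight.
    refine isExposed_of_forall_eq_zero
      (κ := weakTwoOrdersAbove V₂ ⊕ {p : X × X // p ∈ W.1 ∧ p.swap ∈ V₁.1})
      (Sum.elim (fun U => ∑ i ∈ cut U.1, ContinuousLinearMap.proj i)
        fun p => ContinuousLinearMap.proj (R := ℝ) (φ := fun _ : X => ℝ) p.1.2 -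
          ContinuousLinearMap.proj p.1.1)
      (Sum.elim (fun U => minSum (cut U.1).card) fun _ => 0) ?_ ?_
    · rintro x ⟨hx, hx'⟩ (U | p)
      · simpa using hx.1 (cut U.1)
      · have : x p.1.1 ≤ x p.1.2 := hx' p.2.1
        simpa using this
    · ext x
      simp only [mem_ofPred_eq, Sum.forall, Sum.elim_inl, Sum.elim_inr, and_assoc]
      refine and_congr_right fun hx => ?_
      rw [isFlagPoset_weakTwoOrdersAbove.ofSet_le_iff (tightCuts_subset hx)]
      constructor
      · rintro ⟨h1, h2⟩
        refine ⟨hW.trans h1, fun U => by simpa [tightCuts] using h2 U.2, fun p => ?_⟩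
        have h3 : x p.1.1 ≤ x p.1.2 := h1 (hW p.2.1)
        have h4 : x p.1.2 ≤ x p.1.1 := h1 p.2.2
        simpa using sub_eq_zero.2 (h4.antisymm h3)
      · rintro ⟨h0, h1, h2⟩
        refine ⟨fun p hp => ?_, fun U hU => by simpa [tightCuts] using h1 ⟨U, hU⟩⟩
        by_cases hpW : p ∈ W.1
        · exact h0 hpW
        · have h3 := h2 ⟨p.swap, mem_of_not_mem_of_le le_rfl hpW, hp⟩
          exact (sub_eq_zero.1 (by simpa using h3) : x p.1 = x p.2).le
  lo_hi_of_mem_openSegment := by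
    rintro W x hx y hy h1 h2 z ⟨a, b, ha, hb, hab, rfl⟩
    have hz := convex_permutahedronRegion hx hy ha.le hb.le hab
    rw [isFlagPoset_weakTwoOrdersAbove.ofSet_le_iff (tightCuts_subset hx),
      isFlagPoset_weakTwoOrdersAbove.map_ofSet (tightCuts_subset hz)]
    refine ⟨fun p hp => ?_, fun U hU => ?_⟩
    · by_cases hpW : p ∈ W.1
      · exact h1 hpW
      -- The reversed pair is in `W`, so `y` cannot contribute to the inequality at `z`; it must
      -- come from `x`.
      · have h3 := mem_of_not_mem_of_le (le_refl W) hpW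
        have h4 : y p.2 ≤ y p.1 := h2 h3
        have h5 : a * x p.1 + b * y p.1 ≤ a * x p.2 + b * y p.2 := hp
        have h6 : a * x p.1 ≤ a * x p.2 := by
          have := mul_le_mul_of_nonneg_left h4 hb.le
          linarith
        exact le_of_mul_le_mul_left h6 ha
    · have h3 : ∑ i ∈ cut U, (a • x + b • y) i = minSum (cut U).card := hU
      rw [sum_add_smul] at h3
      have h4 := mul_le_mul_of_nonneg_left (hy.1 (cut U)) hb.le
      have h5 : a * minSum (cut U).card + b * minSum (cut U).card = minSum (cut U).card := by
        rw [← add_mul, hab, one_mul]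
      refine le_antisymm (le_of_mul_le_mul_left (a := a) ?_ ha) (hx.1 _)
      linarith

/-! ### Faces of the permutahedron and their barycenters -/

/-- Tightness at all lower sets fixes each coordinate `x a` as the difference of the sums over `{z ≤
a}` and `{z < a}`. -/
theorem isExposed_singleton_permVec (e : X ≃ Fin (Fintype.card X)) :
    IsExposed ℝ (permutahedron X) {permVec e} := by
  classical
  let L := weakOrderOf (permVec e)
  refine (isExposed_of_forall_eq_zero (A := permutahedronRegion X)
    (κ := {s : Finset X // ∀ x y, (x, y) ∈ L.1 → y ∈ s → x ∈ s})
    (fun s => ∑ i ∈ s.1, ContinuousLinearMap.proj i) (fun s => minSum s.1.card)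
    (fun x hx s => by simpa using hx.1 s.1) ?_).mono permutahedron_subset_region
    (singleton_subset_iff.2 (permVec_mem e))
  ext x
  simp only [mem_singleton_iff, mem_ofPred_eq]
  constructor
  · rintro rfl
    exact ⟨permVec_mem_region e, fun s => by simpa using sum_permVec_of_lower e s.2⟩
  · rintro ⟨hx, h⟩
    funext a
    have h1 := h ⟨Finset.univ.filter fun z => (z, a) ∈ L.1, fun x y hxy hy => by
      simpa using L.trans hxy (by simpa using hy)⟩
    have h2 := h ⟨(Finset.univ.filter fun z => (z, a) ∈ L.1).erase a, fun x y hxy hy => by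
      simp only [Finset.mem_erase, Finset.mem_filter_univ] at hy ⊢
      refine ⟨fun hxa => hy.1 ?_, L.trans hxy hy.2⟩
      subst hxa
      exact isLinear_weakOrderOf_permVec e _ _ hy.2 hxy⟩
    have h3 := sum_permVec_of_lower e (s := Finset.univ.filter fun z => (z, a) ∈ L.1)
      fun x y hxy hy => by simpa using L.trans hxy (by simpa using hy)
    have h4 := sum_permVec_of_lower e (s := (Finset.univ.filter fun z => (z, a) ∈ L.1).erase a)
      fun x y hxy hy => by
        simp only [Finset.mem_erase, Finset.mem_filter_univ] at hy ⊢
        refine ⟨fun hxa => hy.1 ?_, L.trans hxy hy.2⟩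
        subst hxa
        exact isLinear_weakOrderOf_permVec e _ _ hy.2 hxy
    simp only [sum_apply, ContinuousLinearMap.proj_apply] at h1 h2
    have ha : a ∈ Finset.univ.filter fun z => (z, a) ∈ L.1 := by simp [L.refl]
    rw [← Finset.add_sum_erase _ _ ha] at h1 h3
    linarith

theorem vertices_eq_of_mem_faces {F : Set (X → ℝ)} (hF : F ∈ faces (permutahedron X)) :
    vertices F = range permVec ∩ F := by
  have hF' : IsExposed ℝ (permutahedron X) F := hF
  ext v
  constructor
  · intro hv
    refine ⟨?_, hv.1⟩
    have h := hF'.isExtreme.extremePoints_subset_extremePoints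
      (exposedPoints_subset_extremePoints hv)
    rw [permutahedron_eq] at h
    exact extremePoints_convexHull_subset h
  · rintro ⟨⟨e, rfl⟩, he⟩
    exact mem_exposedPoints_iff_exposed_singleton.2
      ((isExposed_singleton_permVec e).mono hF'.subset (singleton_subset_iff.2 he))

theorem vertices_permutahedron : vertices (permutahedron X) = range permVec := by
  rw [vertices_eq_of_mem_faces (IsExposed.refl _), inter_eq_left]
  rintro _ ⟨e, rfl⟩
  exact permVec_mem e

/-- The vertices that maximize a linear functional, by the rearrangement inequality. -/
theorem permVec_mem_toExposed_iff (l : StrongDual ℝ (X → ℝ)) {w : X → ℝ}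
    (hw : ∀ x, l x = ∑ i, w i * x i) (e : X ≃ Fin (Fintype.card X)) :
    permVec e ∈ l.toExposed (permutahedron X) ↔ weakOrderOf (permVec e) ≤ weakOrderOf w := by
  have hmono : ∀ e : X ≃ Fin (Fintype.card X),
      Monovary w (permVec e) ↔ weakOrderOf (permVec e) ≤ weakOrderOf w := by
    intro e
    refine ⟨fun h p hp => ?_, fun h i j hij => h (show (i, j) ∈ (weakOrderOf _).1 from hij.le)⟩
    rcases (show permVec e p.1 ≤ permVec e p.2 from hp).lt_or_eq with h' | h'
    · exact h h'
    · have : p.1 = p.2 := isLinear_weakOrderOf_permVec e _ _ h'.le h'.ge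
      exact (congrArg w this).le
  -- A vertex ordered compatibly with `w` is a maximizer. All vertices are rearrangements of it, and
  -- the equality case of the rearrangement inequality picks out the other maximizers.
  obtain ⟨f, hf⟩ := compatible_nonempty (weakOrderOf w)
  have hf := (hmono f).2 (mem_compatible.1 hf)
  have hperm : ∀ e : X ≃ Fin (Fintype.card X), permVec e = permVec f ∘ (e.trans f.symm) := by
    intro e
    funext x
    simp [permVec]
  have hle : ∀ e, l (permVec e) ≤ l (permVec f) := by
    intro e
    rw [hw, hw, hperm e]
    exact hf.sum_mul_comp_perm_le_sum_mul
  have hmax : ∀ y ∈ permutahedron X, l y ≤ l (permVec f) := by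
    rw [permutahedron_eq]
    refine convexHull_min (t := {y | l y ≤ l (permVec f)}) ?_
      (convex_halfSpace_le l.toLinearMap.isLinear _)
    rintro _ ⟨e, rfl⟩
    exact hle e
  have heq : l (permVec e) = l (permVec f) ↔ weakOrderOf (permVec e) ≤ weakOrderOf w := by
    rw [← hmono, hw, hw, hperm e]
    exact hf.sum_mul_comp_perm_eq_sum_mul_iff
  rw [← heq]
  exact ⟨fun h => le_antisymm (hle e) (h.2 _ (permVec_mem f)),
    fun h => ⟨permVec_mem e, fun y hy => h ▸ hmax y hy⟩⟩

theorem barycenter_toExposed (l : StrongDual ℝ (X → ℝ)) {w : X → ℝ}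
    (hw : ∀ x, l x = ∑ i, w i * x i) :
    barycenter (l.toExposed (permutahedron X)) = averageVertex (weakOrderOf w) := by
  have h : vertices (l.toExposed (permutahedron X)) =
      permVec '' (compatible (weakOrderOf w) : Set (X ≃ Fin (Fintype.card X))) := by
    rw [vertices_eq_of_mem_faces ContinuousLinearMap.toExposed.isExposed]
    ext v
    constructor
    · rintro ⟨⟨e, rfl⟩, he⟩
      exact ⟨e, mem_compatible.2 ((permVec_mem_toExposed_iff l hw e).1 he), rfl⟩
    · rintro ⟨e, he, rfl⟩
      exact ⟨⟨e, rfl⟩, (permVec_mem_toExposed_iff l hw e).2 (mem_compatible.1 he)⟩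
  rw [barycenter, h, ncard_image_of_injective _ permVec_injective, ncard_coe_finset,
    finsum_mem_image permVec_injective.injOn, finsum_mem_coe_finset, averageVertex]

theorem vertexCube_permVec (e : X ≃ Fin (Fintype.card X)) :
    vertexCube (permVec e) = (permutahedronRealization X).cell (weakOrderOf (permVec e)) ⊤ := by
  rw [CubicalRealization.cell_eq_convexHull, vertexCube]
  congr 1
  ext b
  constructor
  · rintro ⟨F, hF, he, rfl⟩
    obtain ⟨l, rfl⟩ := hF ⟨_, he⟩
    classical
    have hw : ∀ x, l x = ∑ i, l (Pi.single i 1) * x i := fun x => by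
      have h := LinearMap.pi_apply_eq_sum_univ l.toLinearMap x
      simp only [ContinuousLinearMap.coe_coe, smul_eq_mul] at h
      rw [h]
      refine Finset.sum_congr rfl fun i _ => ?_
      rw [mul_comm]
      congr 2
      funext j
      simp [Pi.single_apply, eq_comm]
    exact ⟨_, ⟨(permVec_mem_toExposed_iff l hw e).1 he, le_top⟩, (barycenter_toExposed l hw).symm⟩
  · rintro ⟨W, ⟨hW, -⟩, rfl⟩
    -- Any coefficient vector with weak order `W` would do; the average vertex is one.
    let l : StrongDual ℝ (X → ℝ) := ∑ i, averageVertex W i • ContinuousLinearMap.proj i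
    have hw : ∀ x, l x = ∑ i, averageVertex W i * x i := fun x => by simp [l]
    refine ⟨l.toExposed (permutahedron X), ContinuousLinearMap.toExposed.isExposed, ?_, ?_⟩
    · rw [permVec_mem_toExposed_iff l hw, weakOrderOf_averageVertex]
      exact hW
    · rw [barycenter_toExposed l hw, weakOrderOf_averageVertex]
      rfl

theorem permutahedronCubes_eq : permutahedronCubes X = (permutahedronRealization X).complex := by
  rw [← CubicalRealization.complex_eq exists_isLinear_le']
  ext F
  simp only [permutahedronCubes, vertices_permutahedron, exists_range_iff, mem_ofPred_eq,
    vertexCube_permVec]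
  constructor
  · rintro ⟨e, he⟩
    exact ⟨_, isLinear_weakOrderOf_permVec e, he⟩
  · rintro ⟨L, hL, hF⟩
    obtain ⟨e, rfl⟩ := exists_weakOrderOf_permVec_eq hL
    exact ⟨e, hF⟩

/-- The description by inequalities falls out of the cells: each point of the region lies in one,
and cells are hulls of averages of vertices. -/
theorem carrier_permutahedronRealization :
    (permutahedronRealization X).carrier = permutahedron X := by
  refine Subset.antisymm (fun x hx => ?_) permutahedron_subset_region
  have h := CubicalRealization.mem_cell_self hx
  rw [CubicalRealization.cell_eq_convexHull] at h
  refine convexHull_min ?_ (convex_convexHull ℝ _) h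
  rintro _ ⟨W, -, rfl⟩
  exact averageVertex_mem W

/-! ### The complex of characteristic vectors -/

variable (X) in
/-- The realization of the weak orders by characteristic vectors. -/
noncomputable def woRealization : CubicalRealization (WO X) (WO2 X → ℝ) :=
  isFlagPoset_weakTwoOrdersAbove.coordinate

theorem woCube_eq (L : WO X) : woCube L = (woRealization X).cell L ⊤ := by
  rw [CubicalRealization.cell_eq_convexHull, woCube]
  congr 1
  ext p
  constructor
  · rintro ⟨W, hW, rfl⟩
    exact ⟨W, ⟨hW, le_top⟩, rfl⟩
  · rintro ⟨W, ⟨hW, -⟩, rfl⟩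
    exact ⟨W, hW, rfl⟩

theorem woComplex_eq : woComplex X = (woRealization X).complex := by
  rw [← CubicalRealization.complex_eq exists_isLinear_le']
  simp only [woComplex, woCube_eq]

end Permutahedron

/-! ### Comparison of the two complexes -/

/-- Both face posets are the poset of intervals of `Ω`, and cells of the same interval correspond.
-/
theorem CubicalRealization.exists_orderIso_complex {Ω E E' : Type*} [PartialOrder Ω]
    [AddCommGroup E] [Module ℝ E] [TopologicalSpace E] [AddCommGroup E'] [Module ℝ E']
    [TopologicalSpace E'] (R : CubicalRealization Ω E) (R' : CubicalRealization Ω E')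
    {C : Set (Set E)} {C' : Set (Set E')} (hC : C = R.complex) (hC' : C' = R'.complex) :
    ∃ φ : C ≃o C', ∀ (F : C) (V W : Ω), V ≤ W → (F : Set E) = R.cell V W →
      (φ F : Set E') = R'.cell V W := by
  subst hC hC'
  obtain ⟨φ, hφ⟩ := R.exists_complexOrderIso
  obtain ⟨ψ, hψ⟩ := R'.exists_complexOrderIso
  refine ⟨φ.symm.trans ψ, fun F V W h hF => ?_⟩
  have : F = φ ((⟨(V, W), h⟩ : NonemptyInterval Ω) : Interval Ω) :=
    Subtype.ext (hF.trans (hφ ⟨(V, W), h⟩).symm)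
  rw [this, OrderIso.trans_apply, OrderIso.symm_apply_apply]
  exact hψ ⟨(V, W), h⟩

end WeakOrderComplex

theorem mainTheorem4 {X : Type*} [Fintype X] (hX : 1 < Fintype.card X) :
    (∀ L ∈ vertices (permutahedron X),
      IsCombinatorialCube (Fintype.card X - 1) (vertexCube L)) ∧
    IsSubdivision (permutahedronCubes X) (permutahedron X) ∧
    IsCubicalComplex (permutahedronCubes X) ∧
    (∃ φ : permutahedronCubes X ≃o woComplex X,
      ∀ (L : X → ℝ) (hL : L ∈ vertices (permutahedron X)),
        (φ ⟨vertexCube L, vertexCube_mem hL⟩ : Set (WO2 X → ℝ)) = woCube (weakOrderOf L)) ∧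
    Nonempty (complexGraph (permutahedronCubes X) ≃g SimpleGraph.hasse (WO X)) ∧
    Nonempty (complexGraph (woComplex X) ≃g SimpleGraph.hasse (WO X)) := by
  refine ⟨fun L hL => ?_, ⟨?_, ?_⟩, ?_, ?_, ?_, ?_⟩
  · rw [vertices_permutahedron] at hL
    obtain ⟨e, rfl⟩ := hL
    have h := CubicalRealization.isCombinatorialCube_cell (R := permutahedronRealization X)
      isFlagPoset_weakTwoOrdersAbove (le_top (a := weakOrderOf (permVec e)))
    rwa [weakTwoOrdersAbove_top, Set.sdiff_empty,
      ncard_weakTwoOrdersAbove_of_isLinear (isLinear_weakOrderOf_permVec e),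
      ← vertexCube_permVec] at h
  · rw [permutahedronCubes_eq]
    exact CubicalRealization.isPolytopalComplex isFlagPoset_weakTwoOrdersAbove
  · rw [permutahedronCubes_eq, CubicalRealization.sUnion_complex, carrier_permutahedronRealization]
  · rw [permutahedronCubes_eq]
    exact CubicalRealization.isCubicalComplex isFlagPoset_weakTwoOrdersAbove
  · obtain ⟨φ, hφ⟩ := (permutahedronRealization X).exists_orderIso_complex (woRealization X)
      permutahedronCubes_eq woComplex_eq
    refine ⟨φ, fun L hL => ?_⟩
    rw [woCube_eq]
    refine hφ _ _ _ le_top ?_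
    obtain ⟨e, rfl⟩ := vertices_permutahedron.subset hL
    exact vertexCube_permVec e
  · rw [permutahedronCubes_eq]
    exact (permutahedronRealization X).nonempty_complexGraph_iso
  · rw [woComplex_eq]
    exact (woRealization X).nonempty_complexGraph_iso
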